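/- **Setting.** Let $k$ be an algebraically closed field and let $\mathcal A$ be a $k$-linear abelian category which is $\mathrm{Hom}$-finite (all $\mathrm{Hom}_{\mathcal A}(X,Y)$ are finite-dimensional over $k$) and hereditary ($\mathrm{Ext}^i(X,Y)=0$ for all $X,Y\in\mathcal A$, $i\ge 2$). Put $\mathcal T=D^b(\mathcal A)\supset\mathcal A$, $\mathrm{Hom}^i(X,Y)=\mathrm{Hom}_{\mathcal T}(X,Y[i])$, and write $\hom^i(X,Y)=0$ if $\mathrm{Hom}^i(X,Y)=0$, $\hom=\hom^0$, and $\hom^*(X,Y)=0$ if $\hom^i(X,Y)=0$ for all $i\in\mathbb Z$. The categories $\mathcal A$ and $\mathcal T$ are Krull–Schmidt; $\mathrm{Ind}(X)$ is the class of objects isomorphic to an indecomposable direct summand of $X$. An object $E\in\mathcal T$ is exceptional if $\mathrm{Hom}(E,E)=k$ and $\hom^i(E,E)=0$ for $i\ne0$; $\mathcal A_{exc}$ is the class of exceptional objects in $\mathcal A$. An Ext-nontrivial couple is a couple $\{\Gamma,\Gamma'\}\subset\mathcal A_{exc}$ with $\hom^1(\Gamma,\Gamma')\neq0$ and $\hom^1(\Gamma',\Gamma)\ne0$.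 *RP property 1:* for each Ext-nontrivial couple $\{\Gamma,\Gamma'\}$ and each $X\in\mathcal A_{exc}$, $\hom^*(\Gamma,X)=0$ implies $\hom^*(X,\Gamma')=0$. *RP property 2:* for each Ext-nontrivial couple $\{\Gamma,\Gamma'\}$ and all $X,Y\in\mathcal A_{exc}$, if $\hom(\Gamma,X)\ne0$, $\hom(X,Y)\neq0$ and $\hom^*(\Gamma,Y)=0$, then $\hom(\Gamma',Y)\neq0$. (Each property is required for both orderings of the couple.) **Stability conditions.** $\mathrm{Stab}(\mathcal T)$ is the set of locally finite Bridgeland stability conditions $\sigma=(\mathcal P,Z)$ on $\mathcal T$; $\sigma^{ss}$ is the class of nonzero objects of $\bigcup_t\mathcal P(t)$. For $X\ne0$, with Harder–Narasimhan (HN) filtration $0=E_0\to E_1\to\dots\to E_n=X$ and factors $A_i\in\mathcal P(t_i)\setminus\{0\}$, $t_1>\dots>t_n$, put $\phi_-(X)=t_n$, $\sigma_-(X)=A_n$, and let $\mathrm{HN}_-(X)$ be the last triangle $E_{n-1}\to X\to\sigma_-(X)\to E_{n-1}[1]$. Let $\theta_\sigma(X)$ be the function on isomorphism classes of indecomposable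 objects of $\sigma^{ss}$ which counts their multiplicities in the HN factors $A_1,\dots,A_n$ of $X$ ($\theta_\sigma(0)=0$). Write $f<g$ if $f\le g$ pointwise and $f\neq g$. **The triangle $\mathrm{alg}(E)$.** Let $E\in\mathcal A_{exc}$, $E\notin\sigma^{ss}$. Then $\sigma_-(E)\cong B_0\oplus B_1[1]$ with $B_0,B_1\in\mathcal A$. The distinguished triangle $\mathrm{alg}(E)=(U\to E\to V\to U[1])$ is, up to isomorphism, the one that completes the component $E\to V=B_0$ of $E\to\sigma_-(E)$ if $B_0\neq0$, and is $\mathrm{HN}_-(E)$ if $B_0=0$. It is of type **C1**, **C2** or **C3** if $U\neq 0$; $V\in\sigma^{ss}$; $V\cong B_0$ or $V\cong B_1[1]$; $\theta_\sigma(U)<\theta_\sigma(E)$; $\phi_-(U)\ge\phi_-(E)$ and $V\in\mathcal P(\phi_-(E))$; $\hom(E,\Gamma)\ne0$ for all $\Gamma\in\mathrm{Ind}(V)$; $\hom^*(U,V)=\hom^1(U,U)=\hom^1(V,V)=0$; and, respectively: * **C1**: $U\cong A$, $V\cong B\cong B_0$ with nonzero $A,B\in\mathcal A$; $\hom^1(A,A)=\hom^1(B,B)=\hom^*(A,B)=0$;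 $B\in\mathcal P(\phi_-(E))$; $\theta_\sigma(A)<\theta_\sigma(E)$; $\phi_-(A)\ge\phi_-(E)$; $\hom^1(B,\Gamma)\neq0$ for all $\Gamma\in\mathrm{Ind}(A)$. * **C2**: $U\cong A_1\oplus A_2[-1]$, $V\cong B\cong B_0$ with $A_1,A_2,B\in\mathcal A$, $A_2\neq0$, $B\ne0$, and $A_1$ a proper subobject of $E$ in $\mathcal A$; $\hom^1(A_2,A_2)=\hom^1(A_1,A_1)=\hom^*(A_1,B)=\hom^*(A_2,B)=\hom^*(A_1,A_2)=0$; $B\in\mathcal P(\phi_-(E))$; $\theta_\sigma(A_1)+\theta_\sigma(A_2[-1])<\theta_\sigma(E)$; $\phi_-(A_1)\ge\phi_-(E)$ (if $A_1\ne0$) and $\phi_-(A_2[-1])\ge\phi_-(E)$; $\hom^1(B,\Gamma)\ne0$ for all $\Gamma\in\mathrm{Ind}(A_1)$; $\hom(B,\Gamma)\ne0$, $\hom^1(\Gamma,E)\neq0$ and $\hom^1(E,\Gamma)=0$ for all $\Gamma\in\mathrm{Ind}(A_2)$. * **C3**: $U\cong A$, $V\cong B[1]$ with nonzero $A,B\in\mathcal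 A$; $\hom^1(A,A)=\hom^1(B,B)=\hom^*(A,B)=0$; $\mathrm{alg}(E)\cong\mathrm{HN}_-(E)$; $\theta_\sigma(A)<\theta_\sigma(E)$; $\phi_-(A)>\phi_-(E)$ and $B\in\mathcal P(\phi_-(E)-1)$; $\hom^1(E,\Gamma)\neq0$ and $\hom^1(\Gamma,E)=0$ for all $\Gamma\in\mathrm{Ind}(B)$; $\hom(B,\Gamma)\ne0$ and $\hom(\Gamma,E)\neq0$ for all $\Gamma\in\mathrm{Ind}(A)$. An exceptional object of $\mathcal T$ has the form $E[j]$ with $E\in\mathcal A_{exc}$, $j\in\mathbb Z$; put $\mathrm{alg}(E[j])=\mathrm{alg}(E)[j]$, of the same type as $\mathrm{alg}(E)$. An object $R\in\mathcal T$ is *$\sigma$-regular* if it is exceptional, $R\notin\sigma^{ss}$, and $\mathrm{alg}(R)$ is of type C1, C2 or C3. For a $\sigma$-regular $R$ with $\mathrm{alg}(R)=(U\to R\to V\to U[1])$, write $R\dashrightarrow^{X}(S,E)$ if $S\in\mathrm{Ind}(V)$ and $E\in\mathrm{Ind}(U)$; here $X=\mathbf{C1}$ or $\mathbf{C3}$ if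 this is the type of $\mathrm{alg}(R)$, and for type C2 one has $X=\mathbf{C2a}$ if $E$ is a component of the summand of $U$ coming from $A_2[-1]$ and $X=\mathbf{C2b}$ if it is a component of the one coming from $A_1$. **Proposition.** If $\mathcal A$ has RP property 1 and RP property 2, then $\mathcal A$ is regularity-preserving: for every $\sigma\in\mathrm{Stab}(D^b(\mathcal A))$, if $R\in D^b(\mathcal A)$ is $\sigma$-regular, $R\dashrightarrow^{X}(S,E)$ with $X\in\{\mathbf{C1},\mathbf{C2a},\mathbf{C2b},\mathbf{C3}\}$, and $E\notin\sigma^{ss}$, then $E$ is $\sigma$-regular. -/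

import Mathlib

open CategoryTheory CategoryTheory.Limits CategoryTheory.Pretriangulated

universe w v u t

noncomputable section

namespace RegStab

/-! ### Generalities on triangulated categories -/

section Triangulated

variable {C : Type u} [Category.{v} C] [Preadditive C] [HasZeroObject C] [HasShift C ℤ]
  [∀ n : ℤ, (shiftFunctor C n).Additive] [Pretriangulated C]

/-- `Hom^i(X, Y) = Hom(X, Y[i])` vanishes. -/
def HomVanish (X Y : C) (i : ℤ) : Prop := ∀ f : X ⟶ Y⟦i⟧, f = 0

/-- `Hom^*(X, Y) = 0`. -/
def HomVanishAll (X Y : C) : Prop := ∀ i : ℤ, HomVanish X Y i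

/-- An exceptional object: `Hom(E, E) = k` and `Hom^i(E, E) = 0` for `i ≠ 0`. -/
def Exceptional (k : Type t) [Field k] [Linear k C] (E : C) : Prop :=
  Module.finrank k (E ⟶ E) = 1 ∧ ∀ i : ℤ, i ≠ 0 → HomVanish E E i

/-- A decomposition of `X` into a finite direct sum of indecomposable objects. -/
structure IndecDecomp (X : C) where
  n : ℕ
  F : Fin n → C
  indec : ∀ i, Indecomposable (F i)
  iso : X ≅ ⨁ F

/-- `Y ∈ Ind(X)`: `Y` is isomorphic to a summand in a decomposition of `X` into indecomposables. -/
def IsInd (Y X : C) : Prop := ∃ (d : IndecDecomp X) (i : Fin d.n), Nonempty (Y ≅ d.F i)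

open Classical in
/-- The number of summands isomorphic to `Y` in a decomposition of `X` into indecomposables.
In a Krull-Schmidt category it does not depend on the chosen decomposition. -/
def multiplicity (X Y : C) : ℕ :=
  if h : Nonempty (IndecDecomp X) then Nat.card {i : Fin h.some.n // Nonempty (Y ≅ h.some.F i)}
  else 0

variable (C) in
/-- The Grothendieck group of a triangulated category. -/
abbrev K0 : Type u :=
  FreeAbelianGroup C ⧸ AddSubgroup.closure
    {x : FreeAbelianGroup C | ∃ T ∈ distTriang C, x = FreeAbelianGroup.of T.obj₂
      - FreeAbelianGroup.of T.obj₁ - FreeAbelianGroup.of T.obj₃}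

/-- The class of an object in the Grothendieck group. -/
def K0.cls (X : C) : K0 C := QuotientAddGroup.mk (FreeAbelianGroup.of X)

/-- The closure of a class of objects under extensions. -/
inductive ExtClosure (S : ObjectProperty C) : ObjectProperty C
  | of (X : C) (hX : S X) : ExtClosure S X
  | ext (T : Triangle C) (hT : T ∈ distTriang C) (h₁ : ExtClosure S T.obj₁)
      (h₃ : ExtClosure S T.obj₃) : ExtClosure S T.obj₂

/-- The full (quasi-abelian) subcategory on `Q` is of finite length: the strict subobjects
(those given by kernels) of each object satisfy both chain conditions. -/
def FiniteLength (Q : ObjectProperty C) : Prop :=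
  ∀ X : Q.FullSubcategory,
    WellFoundedLT {S : Subobject X // Nonempty (NormalMono S.arrow)} ∧
    WellFoundedGT {S : Subobject X // Nonempty (NormalMono S.arrow)}

/-- A Harder-Narasimhan filtration of `X` with respect to `P`: triangles
`E i → E (i+1) → A i → E i [1]` with `E 0 = 0`, last term `X`, and nonzero factors `A i ∈ P (t i)`
of strictly decreasing phases. There are `n + 1` factors. -/
structure HNFiltration (P : ℝ → ObjectProperty C) (X : C) where
  n : ℕ
  E : Fin (n + 2) → C
  A : Fin (n + 1) → C
  t : Fin (n + 1) → ℝ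
  f : ∀ i : Fin (n + 1), E i.castSucc ⟶ E i.succ
  g : ∀ i : Fin (n + 1), E i.succ ⟶ A i
  h : ∀ i : Fin (n + 1), A i ⟶ (E i.castSucc)⟦(1 : ℤ)⟧
  dist : ∀ i, Triangle.mk (f i) (g i) (h i) ∈ distTriang C
  isZero : IsZero (E 0)
  top : E (Fin.last (n + 1)) ≅ X
  anti : StrictAnti t
  mem : ∀ i, P (t i) (A i)
  nonzero : ∀ i, ¬ IsZero (A i)

variable (C) in
/-- A locally finite (Bridgeland) stability condition `σ = (P, Z)` on a triangulated category. -/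
structure StabilityCondition where
  /-- the slicing -/
  P : ℝ → ObjectProperty C
  /-- the central charge -/
  Z : K0 C →+ ℂ
  closedIso : ∀ t, (P t).IsClosedUnderIsomorphisms
  zero_mem : ∀ (t : ℝ) (X : C), IsZero X → P t X
  biprod_mem : ∀ (t : ℝ) (X Y : C), P t X → P t Y → P t (X ⊞ Y)
  shift_mem_iff : ∀ (t : ℝ) (X : C), P (t + 1) (X⟦(1 : ℤ)⟧) ↔ P t X
  hom_eq_zero : ∀ (t₁ t₂ : ℝ) (X Y : C), t₂ < t₁ → P t₁ X → P t₂ Y → ∀ f : X ⟶ Y, f = 0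
  exists_hn : ∀ X : C, ¬ IsZero X → Nonempty (HNFiltration P X)
  charge : ∀ (t : ℝ) (X : C), P t X → ¬ IsZero X →
    ∃ m : ℝ, 0 < m ∧ Z (K0.cls X) = (m : ℂ) * Complex.exp (Real.pi * t * Complex.I)
  locallyFinite : ∃ η : ℝ, 0 < η ∧ η < 1 / 2 ∧ ∀ t : ℝ,
    FiniteLength (ExtClosure fun X => ∃ s ∈ Set.Ioo (t - η) (t + η), P s X)

namespace StabilityCondition

variable (σ : StabilityCondition C)

/-- `σ^{ss}`: the nonzero semistable objects. -/
def Semistable (X : C) : Prop := ¬ IsZero X ∧ ∃ t, σ.P t X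

/-- A chosen Harder-Narasimhan filtration of a nonzero object. -/
def hn (X : C) (hX : ¬ IsZero X) : HNFiltration σ.P X := (σ.exists_hn X hX).some

open Classical in
/-- `φ₋(X)`, the phase of the last Harder-Narasimhan factor (with value `0` for `X = 0`). -/
def phiMinus (X : C) : ℝ := if hX : IsZero X then 0 else (σ.hn X hX).t (Fin.last _)

/-- `σ₋(X)`, the Harder-Narasimhan factor of minimal phase. -/
def sigmaMinus (X : C) (hX : ¬ IsZero X) : C := (σ.hn X hX).A (Fin.last _)

/-- The last map `X ⟶ σ₋(X)` in the Harder-Narasimhan filtration. -/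
def toSigmaMinus (X : C) (hX : ¬ IsZero X) : X ⟶ σ.sigmaMinus X hX :=
  (σ.hn X hX).top.inv ≫ (σ.hn X hX).g (Fin.last _)

/-- `HN₋(X)`, the last triangle `E_{n-1} ⟶ X ⟶ σ₋(X) ⟶ E_{n-1}[1]` of the filtration. -/
def hnMinus (X : C) (hX : ¬ IsZero X) : Triangle C :=
  Triangle.mk ((σ.hn X hX).f (Fin.last _) ≫ (σ.hn X hX).top.hom) (σ.toSigmaMinus X hX)
    ((σ.hn X hX).h (Fin.last _))

/-- The indecomposable semistable objects. -/
abbrev IndecSemistable : Type u := {Y : C // σ.Semistable Y ∧ Indecomposable Y}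

open Classical in
/-- `θ_σ(X)`: it counts, for each indecomposable semistable `Y`, the indecomposable summands
isomorphic to `Y` of the Harder-Narasimhan factors of `X`. It is compared pointwise. -/
def theta (X : C) : σ.IndecSemistable → ℕ := fun Y =>
  if hX : IsZero X then 0 else ∑ i, multiplicity ((σ.hn X hX).A i) Y.1

end StabilityCondition

end Triangulated

/-! ### The bounded derived category and the triangle `alg(E)` -/

section Hereditary

variable {A : Type u} [Category.{v} A] [Abelian A] [HasDerivedCategory.{w} A]

variable (A) in
/-- The bounded derived category `D^b(A)`. -/
abbrev Db : Type (max u v) := DerivedCategory.Bounded A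

variable (A) in
/-- The embedding `A ⥤ D^b(A)` in degree `0`. -/
def emb : A ⥤ Db A :=
  DerivedCategory.TStructure.t.bounded.lift (DerivedCategory.singleFunctor A 0)
    (fun _ => ⟨⟨0, inferInstance⟩, ⟨0, inferInstance⟩⟩)

variable (A) in
/-- `A` is hereditary: `Ext^i(X, Y) = Hom_{D^b(A)}(X, Y[i])` vanishes for `i ≥ 2`. -/
def Hereditary : Prop := ∀ (X Y : A) (i : ℤ), 2 ≤ i → HomVanish ((emb A).obj X) ((emb A).obj Y) i

/-- The triangle `alg(E)`, `U ⟶ E ⟶ V ⟶ U[1]`, of a nonzero object `E` of `A`.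
Write `σ₋(E) = B₀ ⊕ B₁[1]` with `B₀, B₁` in `A`. If `B₀ ≠ 0`, then `E ⟶ V` is the component
`E ⟶ B₀` of `E ⟶ σ₋(E)`; if `B₀ = 0`, then `E ⟶ V` is `E ⟶ σ₋(E)`. The triangle is determined
by this up to isomorphism. -/
structure AlgTriangle (σ : StabilityCondition (Db A)) (E : A)
    (hE : ¬ IsZero ((emb A).obj E)) where
  B₀ : A
  B₁ : A
  split : σ.sigmaMinus _ hE ≅ (emb A).obj B₀ ⊞ ((emb A).obj B₁)⟦(1 : ℤ)⟧
  U : Db A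
  V : Db A
  u : U ⟶ (emb A).obj E
  v : (emb A).obj E ⟶ V
  w : V ⟶ U⟦(1 : ℤ)⟧
  dist : Triangle.mk u v w ∈ distTriang (Db A)
  of_ne_zero : ¬ IsZero B₀ →
    ∃ e : V ≅ (emb A).obj B₀, v ≫ e.hom = σ.toSigmaMinus _ hE ≫ split.hom ≫ biprod.fst
  of_zero : IsZero B₀ →
    ∃ e : V ≅ σ.sigmaMinus _ hE, v ≫ e.hom = σ.toSigmaMinus _ hE

namespace AlgTriangle

variable {σ : StabilityCondition (Db A)} {E : A} {hE : ¬ IsZero ((emb A).obj E)}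

/-- The features common to the types C1, C2, C3. -/
structure RegularFeatures (T : AlgTriangle σ E hE) : Prop where
  U_ne : ¬ IsZero T.U
  V_ss : σ.Semistable T.V
  V_component : Nonempty (T.V ≅ (emb A).obj T.B₀) ∨ Nonempty (T.V ≅ ((emb A).obj T.B₁)⟦(1 : ℤ)⟧)
  theta_lt : σ.theta T.U < σ.theta ((emb A).obj E)
  phase_V : σ.P (σ.phiMinus ((emb A).obj E)) T.V
  phase_U : σ.phiMinus ((emb A).obj E) ≤ σ.phiMinus T.U
  hom_ind : ∀ Γ, IsInd Γ T.V → ¬ HomVanish ((emb A).obj E) Γ 0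
  hom_U_V : HomVanishAll T.U T.V
  hom_U_U : HomVanish T.U T.U 1
  hom_V_V : HomVanish T.V T.V 1

/-- The list of properties C1, for the triangle `X ⟶ E ⟶ B`. -/
structure PropsC1 (T : AlgTriangle σ E hE) (X B : A) : Prop where
  isoU : Nonempty (T.U ≅ (emb A).obj X)
  isoV : Nonempty (T.V ≅ (emb A).obj B)
  X_ne : ¬ IsZero X
  B_ne : ¬ IsZero B
  hom_X_X : HomVanish ((emb A).obj X) ((emb A).obj X) 1
  hom_B_B : HomVanish ((emb A).obj B) ((emb A).obj B) 1
  hom_X_B : HomVanishAll ((emb A).obj X) ((emb A).obj B)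
  component : Nonempty (B ≅ T.B₀)
  phase_B : σ.P (σ.phiMinus ((emb A).obj E)) ((emb A).obj B)
  theta_lt : σ.theta ((emb A).obj X) < σ.theta ((emb A).obj E)
  phase_X : σ.phiMinus ((emb A).obj E) ≤ σ.phiMinus ((emb A).obj X)
  ind_X : ∀ Γ, IsInd Γ ((emb A).obj X) → ¬ HomVanish ((emb A).obj B) Γ 1

/-- The list of properties C2, for the triangle `A₁ ⊕ A₂[-1] ⟶ E ⟶ B`. -/
structure PropsC2 (T : AlgTriangle σ E hE) (A₁ A₂ B : A) : Prop where
  isoU : Nonempty (T.U ≅ (emb A).obj A₁ ⊞ ((emb A).obj A₂)⟦(-1 : ℤ)⟧)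
  isoV : Nonempty (T.V ≅ (emb A).obj B)
  A₂_ne : ¬ IsZero A₂
  B_ne : ¬ IsZero B
  proper : ∃ m : A₁ ⟶ E, Mono m ∧ ¬ IsIso m
  hom_A₂_A₂ : HomVanish ((emb A).obj A₂) ((emb A).obj A₂) 1
  hom_A₁_A₁ : HomVanish ((emb A).obj A₁) ((emb A).obj A₁) 1
  hom_A₁_B : HomVanishAll ((emb A).obj A₁) ((emb A).obj B)
  hom_A₂_B : HomVanishAll ((emb A).obj A₂) ((emb A).obj B)
  hom_A₁_A₂ : HomVanishAll ((emb A).obj A₁) ((emb A).obj A₂)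
  component : Nonempty (B ≅ T.B₀)
  phase_B : σ.P (σ.phiMinus ((emb A).obj E)) ((emb A).obj B)
  theta_lt : σ.theta ((emb A).obj A₁) + σ.theta (((emb A).obj A₂)⟦(-1 : ℤ)⟧) <
    σ.theta ((emb A).obj E)
  phase_A₁ : ¬ IsZero A₁ → σ.phiMinus ((emb A).obj E) ≤ σ.phiMinus ((emb A).obj A₁)
  phase_A₂ : σ.phiMinus ((emb A).obj E) ≤ σ.phiMinus (((emb A).obj A₂)⟦(-1 : ℤ)⟧)
  ind_A₁ : ∀ Γ, IsInd Γ ((emb A).obj A₁) → ¬ HomVanish ((emb A).obj B) Γ 1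
  ind_A₂ : ∀ Γ, IsInd Γ ((emb A).obj A₂) → ¬ HomVanish ((emb A).obj B) Γ 0 ∧
    ¬ HomVanish Γ ((emb A).obj E) 1 ∧ HomVanish ((emb A).obj E) Γ 1

/-- The list of properties C3, for the triangle `X ⟶ E ⟶ B[1]`. -/
structure PropsC3 (T : AlgTriangle σ E hE) (X B : A) : Prop where
  isoU : Nonempty (T.U ≅ (emb A).obj X)
  isoV : Nonempty (T.V ≅ ((emb A).obj B)⟦(1 : ℤ)⟧)
  X_ne : ¬ IsZero X
  B_ne : ¬ IsZero B
  hom_X_X : HomVanish ((emb A).obj X) ((emb A).obj X) 1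
  hom_B_B : HomVanish ((emb A).obj B) ((emb A).obj B) 1
  hom_X_B : HomVanishAll ((emb A).obj X) ((emb A).obj B)
  isoHN : Nonempty (Triangle.mk T.u T.v T.w ≅ σ.hnMinus _ hE)
  theta_lt : σ.theta ((emb A).obj X) < σ.theta ((emb A).obj E)
  phase_X : σ.phiMinus ((emb A).obj E) < σ.phiMinus ((emb A).obj X)
  phase_B : σ.P (σ.phiMinus ((emb A).obj E) - 1) ((emb A).obj B)
  ind_B : ∀ Γ, IsInd Γ ((emb A).obj B) →
    ¬ HomVanish ((emb A).obj E) Γ 1 ∧ HomVanish Γ ((emb A).obj E) 1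
  ind_X : ∀ Γ, IsInd Γ ((emb A).obj X) →
    ¬ HomVanish ((emb A).obj B) Γ 0 ∧ ¬ HomVanish Γ ((emb A).obj E) 0

/-- `alg(E)` is of type C1. -/
def IsC1 (T : AlgTriangle σ E hE) : Prop := T.RegularFeatures ∧ ∃ X B : A, T.PropsC1 X B

/-- `alg(E)` is of type C2. -/
def IsC2 (T : AlgTriangle σ E hE) : Prop := T.RegularFeatures ∧ ∃ A₁ A₂ B : A, T.PropsC2 A₁ A₂ B

/-- `alg(E)` is of type C3. -/
def IsC3 (T : AlgTriangle σ E hE) : Prop := T.RegularFeatures ∧ ∃ X B : A, T.PropsC3 X B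

end AlgTriangle

/-! ### Regular objects, the relation `R ⇢ (S, E)`, RP properties -/

variable (k : Type t) [Field k] [Linear k A]

/-- `R` is a `σ`-regular exceptional object of `D^b(A)`: it is exceptional, not semistable, and
`alg(R)` is of type C1, C2 or C3. Here `R = R'[j]` with `R'` in `A`, and `alg(R) = alg(R')[j]`. -/
def IsRegular (σ : StabilityCondition (Db A)) (R : Db A) : Prop :=
  Exceptional k R ∧ ¬ σ.Semistable R ∧
    ∃ (R' : A) (j : ℤ) (hR' : ¬ IsZero ((emb A).obj R')) (T : AlgTriangle σ R' hR'),
      Nonempty (R ≅ ((emb A).obj R')⟦j⟧) ∧ (T.IsC1 ∨ T.IsC2 ∨ T.IsC3)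

/-- The labels of the relation `R ⇢ (S, E)`. -/
inductive Label
  | C1 | C2a | C2b | C3

/-- The relation `R ⇢ (S, E)` with label `X`: `R` is `σ`-regular, `S ∈ Ind(V)` and `E ∈ Ind(U)`,
where `alg(R)` is `U ⟶ R ⟶ V ⟶ U[1]`; the label is the type of `alg(R)`, and for type C2, where
`U = A₁ ⊕ A₂[-1]`, it is `C2a` if `E` is a component of `A₂[-1]`, and `C2b` if it is a component
of `A₁` (everything shifted by the degree `j` of `R`). -/
def Leads (σ : StabilityCondition (Db A)) (X : Label) (R S E : Db A) : Prop :=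
  Exceptional k R ∧ ¬ σ.Semistable R ∧
    ∃ (R' : A) (j : ℤ) (hR' : ¬ IsZero ((emb A).obj R')) (T : AlgTriangle σ R' hR'),
      Nonempty (R ≅ ((emb A).obj R')⟦j⟧) ∧ IsInd S (T.V⟦j⟧) ∧ IsInd E (T.U⟦j⟧) ∧
      match X with
      | Label.C1 => T.IsC1
      | Label.C2a => T.RegularFeatures ∧ ∃ A₁ A₂ B : A, T.PropsC2 A₁ A₂ B ∧
          IsInd E ((((emb A).obj A₂)⟦(-1 : ℤ)⟧)⟦j⟧)
      | Label.C2b => T.RegularFeatures ∧ ∃ A₁ A₂ B : A, T.PropsC2 A₁ A₂ B ∧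
          IsInd E (((emb A).obj A₁)⟦j⟧)
      | Label.C3 => T.IsC3

/-- `A_exc`: the exceptional objects of `A`. -/
def ExceptionalIn (X : A) : Prop := Exceptional k ((emb A).obj X)

/-- `{L, Γ}` is an Ext-nontrivial couple. -/
def ExtNontrivialCouple (L Γ : A) : Prop :=
  ExceptionalIn k L ∧ ExceptionalIn k Γ ∧
    ¬ HomVanish ((emb A).obj L) ((emb A).obj Γ) 1 ∧ ¬ HomVanish ((emb A).obj Γ) ((emb A).obj L) 1

variable (A)

/-- RP property 1. -/
def RPProperty1 : Prop :=
  ∀ Γ Γ' : A, ExtNontrivialCouple k Γ Γ' → ∀ X : A, ExceptionalIn k X →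
    HomVanishAll ((emb A).obj Γ) ((emb A).obj X) → HomVanishAll ((emb A).obj X) ((emb A).obj Γ')

/-- RP property 2. -/
def RPProperty2 : Prop :=
  ∀ Γ Γ' : A, ExtNontrivialCouple k Γ Γ' → ∀ X Y : A, ExceptionalIn k X → ExceptionalIn k Y →
    ¬ HomVanish ((emb A).obj Γ) ((emb A).obj X) 0 → ¬ HomVanish ((emb A).obj X) ((emb A).obj Y) 0 →
    HomVanishAll ((emb A).obj Γ) ((emb A).obj Y) → ¬ HomVanish ((emb A).obj Γ') ((emb A).obj Y) 0

/-- `A` is regularity-preserving. -/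
def RegularityPreserving : Prop :=
  ∀ (σ : StabilityCondition (Db A)) (X : Label) (R S E : Db A),
    IsRegular k σ R → Leads k σ X R S E → ¬ σ.Semistable E → IsRegular k σ E

end Hereditary

end RegStab

end

/-!
Let `F` be an exceptional object of `A` which is not semistable, and let `s` be the phase of
`σ₋(F) = B₀ ⊕ B₁[1]`. The proof rests on a dichotomy (`regular_or_obstruction`): either the triangle
`alg(F)` is of type C1, C2 or C3, or there is an Ext-nontrivial couple `{F, Γ}` such that
`Homⁱ(Γ, G) = 0` whenever `Hom^*(F, G) = 0` and `G[i]` is semistable of phase at most `s`.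

If `B₀ ≠ 0`, then `alg(F)` is `A₁ ⊕ A₂[-1] ⟶ F ⟶ B₀`, where `A₁` and `A₂` are the kernel and the
cokernel of `F ⟶ B₀` (`exists_fibre`). All required vanishings follow from long exact sequences,
from the vanishing of `Hom` in decreasing phases and from `Ext² = 0`, provided that
`Ext¹(F, A₂) = 0`. Otherwise `Γ` is a summand of `A₂` with `Ext¹(F, Γ) ≠ 0`. It is rigid, hence
exceptional by the argument of Happel and Ringel (`exceptionalIn_of_rigid`), it satisfies
`Ext¹(Γ, F) ≠ 0`, and it lies in `P(≥ s + 1)`. If `B₀ = 0`, then `alg(F)` is `X ⟶ F ⟶ B₁[1]`, which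
is of type C3 as soon as `Ext¹(B₁, F) = 0`; otherwise `Γ` is a summand of `B₁` with
`Ext¹(Γ, F) ≠ 0`. The nonvanishing statements about components of the outer terms hold because
endomorphisms of `F` are scalars (`not_homVanish_obj₃_of_retract_obj₁`). The strict decrease
of `θ_σ` comes from its additivity on triangles that split off a part of the last
Harder-Narasimhan factor (`theta_eq_add`), which in turn needs that multiplicities are well
defined, i.e. the Krull-Schmidt property (`krullSchmidt_Db`).

Now let `U ⟶ R ⟶ V` be the triangle of a regular `R`, and let a shift of `F` be a component of `U`,
so that `Hom^*(F, G) = 0` (up to shift) for all components `G` of `V`. For the labels C1 and C2b,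
choose `G` with `Hom(R, G) ≠ 0`; as `Hom(F, R) ≠ 0`, RP property 2 yields `Hom(Γ, G) ≠ 0` for every
`Γ` that forms an Ext-nontrivial couple with `F`, which excludes the second alternative of the
dichotomy. For C3 and C2a, choose `G` with `Hom(G, F) ≠ 0`; in the second alternative
`Hom^*(Γ, G) = 0`, so that RP property 1 for the couple `{Γ, F}` yields `Hom^*(G, F) = 0`,
a contradiction.
-/

noncomputable section

namespace RegStab

/-! ### Vanishing of morphisms in a triangulated category -/

section Vanishing

set_option linter.unusedSectionVars false

variable {C : Type u} [Category.{v} C] [Preadditive C] [HasZeroObject C] [HasShift C ℤ]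
  [∀ n : ℤ, (shiftFunctor C n).Additive] [Pretriangulated C]

/-- Every morphism from `X` to `Y` is zero. By definition `HomVanish X Y i` is `NoHom X (Y⟦i⟧)`. -/
abbrev NoHom (X Y : C) : Prop := ∀ f : X ⟶ Y, f = 0

lemma NoHom.of_retract {X X' Y Y' : C} (rX : Retract X' X) (rY : Retract Y' Y) (h : NoHom X Y) :
    NoHom X' Y' := by
  intro f
  have : f = rX.i ≫ (rX.r ≫ f ≫ rY.i) ≫ rY.r := by simp
  rw [this, h (rX.r ≫ f ≫ rY.i)]; simp

lemma NoHom.of_iso {X X' Y Y' : C} (eX : X' ≅ X) (eY : Y' ≅ Y) (h : NoHom X Y) : NoHom X' Y' :=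
  h.of_retract (.ofIso eX) (.ofIso eY)

lemma isZero_of_noHom_self {X : C} (h : NoHom X X) : IsZero X :=
  (IsZero.iff_id_eq_zero X).2 (h _)

lemma isZero_of_retract {X Y : C} (r : Retract X Y) (h : IsZero Y) : IsZero X :=
  isZero_of_noHom_self fun f => NoHom.of_retract r r (fun g => h.eq_of_src g 0) f

lemma noHom_shift_iff {X Y : C} (n : ℤ) : NoHom (X⟦n⟧) (Y⟦n⟧) ↔ NoHom X Y := by
  constructor
  · intro h f
    exact (shiftFunctor C n).map_injective (by rw [h (f⟦n⟧'), Functor.map_zero])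
  · intro h f
    obtain ⟨g, rfl⟩ := (shiftFunctor C n).map_surjective f
    rw [h g, Functor.map_zero]

lemma noHom_shift_shift_iff {X Y : C} (a b c : ℤ) (h : c + a = b) :
    NoHom (X⟦a⟧) (Y⟦b⟧) ↔ HomVanish X Y c := by
  have e : Y⟦b⟧ ≅ (Y⟦c⟧)⟦a⟧ := (shiftFunctorAdd' C c a b h).app Y
  refine Iff.trans ?_ (noHom_shift_iff a)
  exact ⟨fun H => NoHom.of_iso (Iso.refl _) e.symm H, fun H => NoHom.of_iso (Iso.refl _) e H⟩

lemma homVanish_shift_iff {X Y : C} (a b i j : ℤ) (h : j + a = b + i) :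
    HomVanish (X⟦a⟧) (Y⟦b⟧) i ↔ HomVanish X Y j := by
  have e : Y⟦b + i⟧ ≅ (Y⟦b⟧)⟦i⟧ := (shiftFunctorAdd C b i).app Y
  rw [← noHom_shift_shift_iff a (b + i) j h]
  exact ⟨fun H => NoHom.of_iso (Iso.refl _) e H, fun H => NoHom.of_iso (Iso.refl _) e.symm H⟩

lemma homVanish_zero_iff {X Y : C} : HomVanish X Y 0 ↔ NoHom X Y := by
  have e : Y⟦(0 : ℤ)⟧ ≅ Y := (shiftFunctorZero C ℤ).app Y
  exact ⟨fun H => NoHom.of_iso (Iso.refl _) e.symm H, fun H => NoHom.of_iso (Iso.refl _) e H⟩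

lemma homVanish_shift_right_iff {X Y : C} (b i j : ℤ) (h : j = b + i) :
    HomVanish X (Y⟦b⟧) i ↔ HomVanish X Y j := by
  have e : Y⟦j⟧ ≅ (Y⟦b⟧)⟦i⟧ := (shiftFunctorAdd' C b i j h.symm).app Y
  exact ⟨fun H => NoHom.of_iso (Iso.refl _) e H, fun H => NoHom.of_iso (Iso.refl _) e.symm H⟩

lemma homVanish_shift_left_iff {X Y : C} (a i j : ℤ) (h : j + a = i) :
    HomVanish (X⟦a⟧) Y i ↔ HomVanish X Y j :=
  noHom_shift_shift_iff a i j h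

lemma HomVanish.of_retract {X X' Y Y' : C} {i : ℤ} (rX : Retract X' X) (rY : Retract Y' Y)
    (h : HomVanish X Y i) : HomVanish X' Y' i :=
  NoHom.of_retract rX (rY.map (shiftFunctor C i)) h

lemma HomVanish.of_iso {X X' Y Y' : C} {i : ℤ} (eX : X' ≅ X) (eY : Y' ≅ Y)
    (h : HomVanish X Y i) : HomVanish X' Y' i :=
  h.of_retract (.ofIso eX) (.ofIso eY)

section Triangle

variable {T : Triangle C} (hT : T ∈ distTriang C) {W : C}
include hT

lemma noHom_to₂ (h₁ : NoHom W T.obj₁) (h₃ : NoHom W T.obj₃) : NoHom W T.obj₂ := by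
  intro f
  obtain ⟨g, rfl⟩ := T.coyoneda_exact₂ hT f (h₃ _)
  rw [h₁ g, zero_comp]

lemma noHom_to₃ (h₂ : NoHom W T.obj₂) (h₁ : NoHom W (T.obj₁⟦(1 : ℤ)⟧)) : NoHom W T.obj₃ := by
  intro f
  obtain ⟨g, rfl⟩ := T.coyoneda_exact₃ hT f (h₁ _)
  rw [h₂ g, zero_comp]

lemma noHom_from₂ (h₁ : NoHom T.obj₁ W) (h₃ : NoHom T.obj₃ W) : NoHom T.obj₂ W := by
  intro f
  obtain ⟨g, rfl⟩ := T.yoneda_exact₂ hT f (h₁ _)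
  rw [h₃ g, comp_zero]

lemma noHom_from₃ (h₂ : NoHom T.obj₂ W) (h₁ : NoHom (T.obj₁⟦(1 : ℤ)⟧) W) : NoHom T.obj₃ W := by
  intro f
  obtain ⟨g, rfl⟩ := T.yoneda_exact₃ hT f (h₂ _)
  rw [h₁ g, comp_zero]

lemma homVanish_to₂ (i : ℤ) (h₁ : HomVanish W T.obj₁ i) (h₃ : HomVanish W T.obj₃ i) :
    HomVanish W T.obj₂ i :=
  noHom_to₂ (T.shift_distinguished hT i) h₁ h₃

lemma homVanish_to₃ (i j : ℤ) (hij : i + 1 = j) (h₂ : HomVanish W T.obj₂ i)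
    (h₁ : HomVanish W T.obj₁ j) : HomVanish W T.obj₃ i :=
  noHom_to₃ (T.shift_distinguished hT i) h₂
    ((homVanish_shift_right_iff (i := 1) i j hij.symm).2 h₁)

lemma homVanish_to₁ (i j : ℤ) (hij : i + 1 = j) (h₃ : HomVanish W T.obj₃ i)
    (h₂ : HomVanish W T.obj₂ j) : HomVanish W T.obj₁ j :=
  (homVanish_shift_right_iff 1 i j (by lia)).1
    (homVanish_to₃ (rot_of_distTriang T hT) i j hij h₃ h₂)

lemma homVanish_from₂ (i : ℤ) (h₁ : HomVanish T.obj₁ W i) (h₃ : HomVanish T.obj₃ W i) :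
    HomVanish T.obj₂ W i :=
  noHom_from₂ hT h₁ h₃

lemma homVanish_from₃ (i j : ℤ) (hij : i + 1 = j) (h₁ : HomVanish T.obj₁ W i)
    (h₂ : HomVanish T.obj₂ W j) : HomVanish T.obj₃ W j :=
  noHom_from₃ hT h₂ ((homVanish_shift_left_iff 1 j i hij).2 h₁)

lemma homVanish_from₁ (i j : ℤ) (hij : i + 1 = j) (h₂ : HomVanish T.obj₂ W i)
    (h₃ : HomVanish T.obj₃ W j) : HomVanish T.obj₁ W i :=
  (homVanish_shift_left_iff 1 j i hij).1
    (homVanish_from₃ (rot_of_distTriang T hT) i j hij h₂ h₃)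

/-- If the second map were zero, then `T.obj₃` would be a summand of `T.obj₁⟦1⟧`, from which it
receives no morphisms. -/
lemma mor₂_ne_zero_of_homVanish (h : HomVanish T.obj₁ T.obj₃ (-1)) (h₃ : ¬ IsZero T.obj₃) :
    T.mor₂ ≠ 0 := by
  intro h₂
  obtain ⟨g, hg⟩ := T.yoneda_exact₃ hT (𝟙 _) (by rw [h₂, zero_comp])
  have h0 : g = 0 := homVanish_zero_iff.1 ((homVanish_shift_left_iff 1 0 (-1) (by lia)).2 h) g
  exact h₃ ((IsZero.iff_id_eq_zero _).2 (by rw [hg, h0, comp_zero]))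

end Triangle

/-- An isomorphism between the middle terms of two distinguished triangles extends to an
isomorphism of triangles if there are no morphisms from the first terms, or their shifts,
to the third ones. -/
lemma triangle_iso_of_noHom {T T' : Triangle C} (hT : T ∈ distTriang C) (hT' : T' ∈ distTriang C)
    (e : T.obj₂ ≅ T'.obj₂) (h : ∀ i : ℤ, i ≤ 0 → ∀ A ∈ [T.obj₁, T'.obj₁],
      ∀ B ∈ [T.obj₃, T'.obj₃], HomVanish A B i) :
    Nonempty (T.obj₁ ≅ T'.obj₁) ∧ Nonempty (T.obj₃ ≅ T'.obj₃) := by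
  have key : ∀ {T T' : Triangle C}, T ∈ distTriang C → T' ∈ distTriang C →
      ∀ φ : T.obj₂ ⟶ T'.obj₂, NoHom T.obj₁ T'.obj₃ → ∃ f : T ⟶ T', f.hom₂ = φ := by
    intro T T' hT hT' φ h
    obtain ⟨a, comm₁⟩ := T'.coyoneda_exact₂ hT' (T.mor₁ ≫ φ) (h _)
    obtain ⟨c, comm₂, comm₃⟩ := complete_distinguished_triangle_morphism _ _ hT hT' a φ comm₁
    exact ⟨{ hom₁ := a, hom₂ := φ, hom₃ := c }, rfl⟩
  -- an endomorphism of a triangle is determined by its middle component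
  have ext : ∀ {T : Triangle C}, T ∈ distTriang C → ∀ f : T ⟶ T, f.hom₂ = 𝟙 _ →
      HomVanish T.obj₁ T.obj₃ (-1) → f.hom₁ = 𝟙 _ ∧ f.hom₃ = 𝟙 _ := by
    intro T hT f hf h
    constructor
    · rw [← sub_eq_zero]
      obtain ⟨g, hg⟩ := Triangle.coyoneda_exact₂ _ (inv_rot_of_distTriang _ hT)
        (f.hom₁ - 𝟙 _) (by
          have h₁ := f.comm₁
          rw [hf] at h₁
          simp only [Category.comp_id] at h₁
          change (f.hom₁ - 𝟙 _) ≫ T.mor₁ = 0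
          rw [Preadditive.sub_comp, ← h₁, Category.id_comp, sub_self])
      have : g = 0 := h g
      rw [this, zero_comp] at hg
      exact hg
    · rw [← sub_eq_zero]
      obtain ⟨g, hg⟩ := T.yoneda_exact₃ hT (f.hom₃ - 𝟙 _) (by
          simp [Preadditive.comp_sub, f.comm₂, hf])
      have : g = 0 := (homVanish_zero_iff.1 ((homVanish_shift_left_iff 1 0 (-1) (by lia)).2 h)) g
      rw [this, comp_zero] at hg
      exact hg
  obtain ⟨f, hf⟩ := key hT hT' e.hom (homVanish_zero_iff.1 (h 0 le_rfl _ (by simp) _ (by simp)))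
  obtain ⟨g, hg⟩ := key hT' hT e.inv (homVanish_zero_iff.1 (h 0 le_rfl _ (by simp) _ (by simp)))
  have h1 := ext hT (f ≫ g) (by simp [hf, hg]) (h (-1) (by lia) _ (by simp) _ (by simp))
  have h2 := ext hT' (g ≫ f) (by simp [hf, hg]) (h (-1) (by lia) _ (by simp) _ (by simp))
  exact ⟨⟨⟨f.hom₁, g.hom₁, h1.1, h2.1⟩⟩, ⟨⟨f.hom₃, g.hom₃, h1.2, h2.2⟩⟩⟩

/-- Distinguished triangles may be transported along isomorphisms of their objects. -/
lemma distinguished_of_isos {X X' Y Y' Z Z' : C} {f : X ⟶ Y} {g : Y ⟶ Z} {h : Z ⟶ X⟦(1 : ℤ)⟧}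
    (hT : Triangle.mk f g h ∈ distTriang C) (a : X ≅ X') (b : Y ≅ Y') (c : Z ≅ Z') :
    Triangle.mk (a.inv ≫ f ≫ b.hom) (b.inv ≫ g ≫ c.hom) (c.inv ≫ h ≫ a.hom⟦(1 : ℤ)⟧') ∈
      distTriang C := by
  refine isomorphic_distinguished _ hT _ (Triangle.isoMk _ _ a.symm b.symm c.symm ?_ ?_ ?_)
  · change (a.inv ≫ f ≫ b.hom) ≫ b.inv = a.inv ≫ f
    simp
  · change (b.inv ≫ g ≫ c.hom) ≫ c.inv = b.inv ≫ g
    simp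
  · change (c.inv ≫ h ≫ a.hom⟦(1 : ℤ)⟧') ≫ a.inv⟦(1 : ℤ)⟧' = c.inv ≫ h
    rw [Category.assoc, Category.assoc, ← Functor.map_comp, Iso.hom_inv_id,
      CategoryTheory.Functor.map_id, Category.comp_id]

/-- The two obvious objects of a biproduct are retracts of it. -/
def retractLeft (X Y : C) : Retract X (X ⊞ Y) := ⟨biprod.inl, biprod.fst, by simp⟩

/-- See `retractLeft`. -/
def retractRight (X Y : C) : Retract Y (X ⊞ Y) := ⟨biprod.inr, biprod.snd, by simp⟩

/-- The inclusion of a nonzero retract into an indecomposable object is an isomorphism. -/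
lemma Indecomposable.isIso_of_retract {X Y : C} (hY : Indecomposable Y) (r : Retract X Y)
    (hX : ¬ IsZero X) : IsIso r.i := by
  obtain ⟨Z, g, h, hT⟩ := distinguished_cocone_triangle r.i
  have : h = 0 := Triangle.mor₃_eq_zero_of_mono₁ _ hT (inferInstanceAs (Mono r.i))
  obtain ⟨e, -⟩ := exists_iso_binaryBiproduct_of_distTriang _ hT this
  obtain h | h := hY.2 _ _ e
  · exact (hX h).elim
  · exact (Triangle.isZero₃_iff_isIso₁ _ hT).1 h

lemma Indecomposable.iso_of_retract {X Y : C} (hY : Indecomposable Y) (r : Retract X Y)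
    (hX : ¬ IsZero X) : Nonempty (X ≅ Y) :=
  have := Indecomposable.isIso_of_retract hY r hX
  ⟨asIso r.i⟩

lemma noHom_biprod_left {W X Y : C} (hX : NoHom X W) (hY : NoHom Y W) : NoHom (X ⊞ Y) W := by
  intro f
  ext <;> simp [hX _, hY _]

/-- The sum of two distinguished triangles is distinguished. -/
lemma exists_sum_triangle {T T' : Triangle C} (hT : T ∈ distTriang C) (hT' : T' ∈ distTriang C) :
    ∃ S ∈ distTriang C, Nonempty (S.obj₁ ≅ T.obj₁ ⊞ T'.obj₁) ∧
      Nonempty (S.obj₂ ≅ T.obj₂ ⊞ T'.obj₂) ∧ Nonempty (S.obj₃ ≅ T.obj₃ ⊞ T'.obj₃) := by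
  have key : ∀ F : Bool → C, Nonempty ((∏ᶜ F) ≅ F true ⊞ F false) := fun F =>
    ⟨{ hom := biprod.lift (Pi.π F true) (Pi.π F false)
       inv := Pi.lift fun j => match j with
        | true => biprod.fst
        | false => biprod.snd
       hom_inv_id := by
        refine Limits.Pi.hom_ext _ _ fun j => ?_
        cases j <;> simp
       inv_hom_id := by ext <;> simp }⟩
  exact ⟨productTriangle fun b : Bool => cond b T T',
    productTriangle_distinguished _ (by rintro (_ | _) <;> assumption),
    key (fun b => (cond b T T').obj₁), key (fun b => (cond b T T').obj₂),
    key (fun b => (cond b T T').obj₃)⟩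

end Vanishing

/-! ### Slicings -/

section Slicing

set_option linter.unusedSectionVars false

variable {C : Type u} [Category.{v} C] [Preadditive C] [HasZeroObject C] [HasShift C ℤ]
  [∀ n : ℤ, (shiftFunctor C n).Additive] [Pretriangulated C]

/-- Morphisms out of the steps of a filtration are controlled by its factors. -/
lemma HNFiltration.noHom_E {P : ℝ → ObjectProperty C} {X Y : C} (F : HNFiltration P X)
    (i : Fin (F.n + 2)) (h : ∀ j : Fin (F.n + 1), j.castSucc < i → NoHom (F.A j) Y) :
    NoHom (F.E i) Y := by
  induction i using Fin.induction with
  | zero => exact fun f => F.isZero.eq_of_src f 0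
  | succ i ih =>
    exact noHom_from₂ (F.dist i) (ih fun j hj => h j (hj.trans (Fin.castSucc_lt_succ)))
      (h i (Fin.castSucc_lt_succ))

namespace StabilityCondition

variable (σ : StabilityCondition C)

/-- `X` lies in `P(> t)`, expressed by the vanishing of morphisms to the semistable objects of
phase at most `t`. -/
def Gt (t : ℝ) (X : C) : Prop := ∀ r ≤ t, ∀ Q, σ.P r Q → NoHom X Q

/-- `X` lies in `P(≥ t)`, expressed by the vanishing of morphisms to the semistable objects of
phase less than `t`. -/
def Ge (t : ℝ) (X : C) : Prop := ∀ r < t, ∀ Q, σ.P r Q → NoHom X Q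

variable {σ}

lemma mem_of_iso {t : ℝ} {X Y : C} (e : X ≅ Y) (h : σ.P t X) : σ.P t Y :=
  (σ.closedIso t).of_iso e h

lemma mem_shift_iff (n : ℤ) (t : ℝ) (X : C) : σ.P (t + n) (X⟦n⟧) ↔ σ.P t X := by
  induction n using Int.induction_on with
  | zero =>
    have e : X⟦(0 : ℤ)⟧ ≅ X := (shiftFunctorZero C ℤ).app X
    simp only [Int.cast_zero, add_zero]
    exact ⟨mem_of_iso e, mem_of_iso e.symm⟩
  | succ n ih =>
    have e : X⟦(n + 1 : ℤ)⟧ ≅ (X⟦(n : ℤ)⟧)⟦(1 : ℤ)⟧ := (shiftFunctorAdd C (n : ℤ) 1).app X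
    rw [← ih, ← σ.shift_mem_iff _ (X⟦(n : ℤ)⟧)]
    have : t + ((n + 1 : ℤ) : ℝ) = t + ((n : ℤ) : ℝ) + 1 := by push_cast; ring
    rw [this]
    exact ⟨mem_of_iso e, mem_of_iso e.symm⟩
  | pred n ih =>
    have e : X⟦(-n : ℤ)⟧ ≅ (X⟦(-n - 1 : ℤ)⟧)⟦(1 : ℤ)⟧ :=
      (shiftFunctorAdd' C (-n - 1 : ℤ) 1 (-n : ℤ) (by lia)).app X
    rw [← ih, ← σ.shift_mem_iff]
    have : t + ((-n : ℤ) : ℝ) = t + ((-n - 1 : ℤ) : ℝ) + 1 := by push_cast; ring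
    rw [this]
    exact ⟨mem_of_iso e.symm, mem_of_iso e⟩

lemma mem_shift {t s : ℝ} {X : C} (n : ℤ) (h : σ.P t X) (hs : s = t + n) : σ.P s (X⟦n⟧) := by
  rw [hs]; exact (mem_shift_iff n t X).2 h

lemma mem_of_shift {t s : ℝ} {X : C} (n : ℤ) (h : σ.P s (X⟦n⟧)) (hs : s = t + n) : σ.P t X := by
  rw [hs] at h; exact (mem_shift_iff n t X).1 h

lemma semistable_of_iso {X Y : C} (e : X ≅ Y) (h : σ.Semistable X) : σ.Semistable Y :=
  ⟨fun h' => h.1 (h'.of_iso e), h.2.imp fun _ => mem_of_iso e⟩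

lemma isZero_shift_iff {X : C} (n : ℤ) : IsZero (X⟦n⟧) ↔ IsZero X := by
  constructor
  · intro h
    exact isZero_of_noHom_self ((noHom_shift_iff n).1 fun f => h.eq_of_src f 0)
  · exact fun h => (shiftFunctor C n).map_isZero h

lemma semistable_of_shift {X : C} (n : ℤ) (h : σ.Semistable X) : σ.Semistable (X⟦n⟧) :=
  ⟨fun h' => h.1 ((isZero_shift_iff n).1 h'), h.2.elim fun t ht => ⟨t + n, mem_shift n ht rfl⟩⟩

lemma Gt.ge {t : ℝ} {X : C} (h : σ.Gt t X) : σ.Ge t X := fun r hr => h r hr.le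

lemma Ge.gt {s t : ℝ} {X : C} (h : σ.Ge t X) (hst : s < t) : σ.Gt s X :=
  fun r hr => h r (hr.trans_lt hst)

lemma Ge.mono {s t : ℝ} {X : C} (h : σ.Ge t X) (hst : s ≤ t) : σ.Ge s X :=
  fun r hr => h r (hr.trans_le hst)

lemma gt_of_mem {s t : ℝ} {X : C} (h : σ.P s X) (hts : t < s) : σ.Gt t X :=
  fun r hr Q hQ => σ.hom_eq_zero s r X Q (hr.trans_lt hts) h hQ

lemma ge_of_mem {s t : ℝ} {X : C} (h : σ.P s X) (hts : t ≤ s) : σ.Ge t X :=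
  fun r hr Q hQ => σ.hom_eq_zero s r X Q (hr.trans_le hts) h hQ

lemma Gt.of_retract {t : ℝ} {X Y : C} (h : σ.Gt t Y) (r : Retract X Y) : σ.Gt t X :=
  fun s hs Q hQ => NoHom.of_retract r (.refl Q) (h s hs Q hQ)

lemma Ge.of_retract {t : ℝ} {X Y : C} (h : σ.Ge t Y) (r : Retract X Y) : σ.Ge t X :=
  fun s hs Q hQ => NoHom.of_retract r (.refl Q) (h s hs Q hQ)

lemma Ge.ext {t : ℝ} {T : Triangle C} (hT : T ∈ distTriang C) (h₁ : σ.Ge t T.obj₁)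
    (h₃ : σ.Ge t T.obj₃) : σ.Ge t T.obj₂ :=
  fun s hs Q hQ => noHom_from₂ hT (h₁ s hs Q hQ) (h₃ s hs Q hQ)

lemma Gt.biprod {t : ℝ} {X Y : C} (hX : σ.Gt t X) (hY : σ.Gt t Y) : σ.Gt t (X ⊞ Y) :=
  fun s hs Q hQ => noHom_biprod_left (hX s hs Q hQ) (hY s hs Q hQ)

lemma Gt.homVanish {r t : ℝ} {X Q : C} (h : σ.Gt t X) (hQ : σ.P r Q) (i : ℤ) (hi : r + i ≤ t) :
    HomVanish X Q i :=
  h _ hi _ (mem_shift i hQ rfl)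

lemma Gt.homVanish_of_nonpos {t : ℝ} {X Q : C} (h : σ.Gt t X) (hQ : σ.P t Q) {i : ℤ}
    (hi : i ≤ 0) : HomVanish X Q i := by
  have : (i : ℝ) ≤ 0 := by exact_mod_cast hi
  exact h.homVanish hQ i (by linarith)

lemma Ge.shift {s t : ℝ} {X : C} (n : ℤ) (h : σ.Ge t X) (hs : s = t + n) : σ.Ge s (X⟦n⟧) := by
  intro r hr Q hQ
  have e : Q ≅ (Q⟦-n⟧)⟦n⟧ := (shiftFunctorCompIsoId C (-n) n (by simp)).symm.app Q
  refine NoHom.of_iso (Iso.refl _) e ((noHom_shift_iff n).2 (h (r + ((-n : ℤ) : ℝ)) ?_ _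
    (mem_shift (-n) hQ rfl)))
  push_cast
  linarith

variable (σ) in
lemma hnMinus_distinguished (X : C) (hX : ¬ IsZero X) : σ.hnMinus X hX ∈ distTriang C := by
  simpa using! distinguished_of_isos ((σ.hn X hX).dist (Fin.last _)) (Iso.refl _)
    (σ.hn X hX).top (Iso.refl _)

lemma phiMinus_eq (X : C) (hX : ¬ IsZero X) :
    σ.phiMinus X = (σ.hn X hX).t (Fin.last _) := by
  simp [phiMinus, hX]

lemma hn_gt (X : C) (hX : ¬ IsZero X) (i : Fin ((σ.hn X hX).n + 1)) :
    σ.Gt ((σ.hn X hX).t i) ((σ.hn X hX).E i.castSucc) := by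
  intro r hr Q hQ
  refine (σ.hn X hX).noHom_E _ fun j hj => ?_
  exact gt_of_mem ((σ.hn X hX).mem j) ((σ.hn X hX).anti (by simpa using hj)) r hr Q hQ

lemma hnMinus_gt (X : C) (hX : ¬ IsZero X) : σ.Gt (σ.phiMinus X) (σ.hnMinus X hX).obj₁ := by
  rw [phiMinus_eq X hX]
  exact hn_gt X hX _

lemma sigmaMinus_mem (X : C) (hX : ¬ IsZero X) : σ.P (σ.phiMinus X) (σ.sigmaMinus X hX) := by
  rw [phiMinus_eq X hX]
  exact (σ.hn X hX).mem _

lemma sigmaMinus_not_isZero (X : C) (hX : ¬ IsZero X) : ¬ IsZero (σ.sigmaMinus X hX) :=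
  (σ.hn X hX).nonzero _

lemma toSigmaMinus_ne_zero (X : C) (hX : ¬ IsZero X) : σ.toSigmaMinus X hX ≠ 0 :=
  mor₂_ne_zero_of_homVanish (σ.hnMinus_distinguished X hX)
    ((hnMinus_gt X hX).homVanish_of_nonpos (sigmaMinus_mem X hX) (by lia))
    (sigmaMinus_not_isZero X hX)

lemma ge_phiMinus (X : C) (hX : ¬ IsZero X) : σ.Ge (σ.phiMinus X) X :=
  Ge.ext (σ.hnMinus_distinguished X hX) (hnMinus_gt X hX).ge
    (ge_of_mem (sigmaMinus_mem X hX) le_rfl)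

lemma le_phiMinus {t : ℝ} {X : C} (hX : ¬ IsZero X) (h : σ.Ge t X) : t ≤ σ.phiMinus X := by
  by_contra! ht
  exact toSigmaMinus_ne_zero X hX (h _ ht _ (sigmaMinus_mem X hX) _)

lemma lt_phiMinus {t : ℝ} {X : C} (hX : ¬ IsZero X) (h : σ.Gt t X) : t < σ.phiMinus X := by
  by_contra! ht
  exact toSigmaMinus_ne_zero X hX (h _ ht _ (sigmaMinus_mem X hX) _)

/-- There are no morphisms from `P(> t)` to the objects that receive none from semistable
objects of phase greater than `t`. -/
lemma Gt.noHom {t : ℝ} {X Y : C} (h : σ.Gt t X) (hY : ∀ r > t, ∀ Q, σ.P r Q → NoHom Q Y) :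
    NoHom X Y := by
  by_cases hX : IsZero X
  · exact fun f => hX.eq_of_src f 0
  · have ht := lt_phiMinus hX h
    rw [phiMinus_eq X hX] at ht
    refine NoHom.of_iso (σ.hn X hX).top.symm (Iso.refl Y) ((σ.hn X hX).noHom_E _ fun j _ => ?_)
    exact hY _ (ht.trans_le ((σ.hn X hX).anti.antitone (Fin.le_last j))) _ ((σ.hn X hX).mem j)

/-- The subcategories `P(t)` are closed under direct summands. -/
lemma mem_of_retract {t : ℝ} {X Y : C} (h : σ.P t Y) (r : Retract X Y) : σ.P t X := by
  by_cases hX : IsZero X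
  · exact σ.zero_mem t X hX
  have hXY : ∀ s > t, ∀ Q, σ.P s Q → NoHom Q X := fun s hs Q hQ =>
    NoHom.of_retract (.refl Q) r (σ.hom_eq_zero s t Q Y hs hQ h)
  have ht : t ≤ σ.phiMinus X := le_phiMinus hX ((ge_of_mem h le_rfl).of_retract r)
  have hT := σ.hnMinus_distinguished X hX
  have hU := hnMinus_gt (σ := σ) X hX
  have hu : (σ.hnMinus X hX).mor₁ = 0 :=
    hU.noHom (fun s hs Q hQ => hXY s (ht.trans_lt hs) Q hQ) _
  -- the first map of the last triangle vanishes, so its first object is a summand of the third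
  -- one up to shift, and there are no morphisms between these
  have hzero : IsZero (σ.hnMinus X hX).obj₁ := by
    have := Triangle.mono₂ _ hT hu
    obtain ⟨g, hg⟩ := Triangle.coyoneda_exact₁ _ hT (𝟙 _) (by rw [hu]; simp)
    have h0 : NoHom ((σ.hnMinus X hX).obj₁⟦(1 : ℤ)⟧) (σ.hnMinus X hX).obj₃ :=
      homVanish_zero_iff.1 ((homVanish_shift_left_iff 1 0 (-1) (by lia)).2
        (hU.homVanish (sigmaMinus_mem X hX) (-1) (by push_cast; linarith)))
    rw [← isZero_shift_iff 1, IsZero.iff_id_eq_zero, hg, h0 g, zero_comp]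
  have := (Triangle.isZero₁_iff_isIso₂ _ hT).1 hzero
  have hmem : σ.P (σ.phiMinus X) X :=
    mem_of_iso (asIso (σ.hnMinus X hX).mor₂).symm (sigmaMinus_mem X hX)
  obtain h' | h' := ht.lt_or_eq
  · exact (hX (isZero_of_noHom_self (hXY _ h' _ hmem))).elim
  · rwa [h']

end StabilityCondition

end Slicing

/-! ### Local algebras with residue field `k` -/

section SplitLocal

/-- Every element of the `k`-algebra `R` is the sum of a scalar and a nilpotent element. For a
nontrivial `R` this means that `R` is local with nil radical and residue field `k`. -/
def ScalarAddNilpotent (k : Type*) [Field k] (R : Type*) [Ring R] [Algebra k R] : Prop :=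
  ∀ f : R, ∃ c : k, IsNilpotent (f - algebraMap k R c)

variable {k : Type*} [Field k] {R : Type*} [Ring R] [Algebra k R]

lemma isUnit_algebraMap_add_of_isNilpotent {c : k} (hc : c ≠ 0) {n : R} (hn : IsNilpotent n) :
    IsUnit (algebraMap k R c + n) := by
  have hu : IsUnit (algebraMap k R c) := (IsUnit.mk0 c hc).map (algebraMap k R)
  exact hn.isUnit_add_left_of_commute hu (Algebra.commutes c n).symm

namespace ScalarAddNilpotent

variable (h : ScalarAddNilpotent k R)
include h

lemma isNilpotent_or_isUnit (f : R) : IsNilpotent f ∨ IsUnit f := by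
  obtain ⟨c, hc⟩ := h f
  by_cases h0 : c = 0
  · left; simpa [h0] using hc
  · right; simpa using isUnit_algebraMap_add_of_isNilpotent h0 hc

variable [Nontrivial R]

omit h [Algebra k R] [Field k] in
lemma not_isUnit_of_isNilpotent {n : R} (hn : IsNilpotent n) : ¬ IsUnit n := fun hu => by
  obtain ⟨m, hm⟩ := hn
  exact not_isUnit_zero (hm ▸ hu.pow m)

/-- Otherwise `n * g` is a unit, and `n` is a nilpotent element with a right inverse. -/
lemma isNilpotent_mul {n : R} (hn : IsNilpotent n) (g : R) : IsNilpotent (n * g) := by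
  refine (h.isNilpotent_or_isUnit _).resolve_right fun hu => ?_
  obtain ⟨m, hm⟩ := hn
  obtain ⟨u, hu⟩ := hu
  have h1 : n * (g * ↑u⁻¹) = 1 := by rw [← mul_assoc, ← hu, Units.mul_inv]
  have h2 : ∀ j, n ^ j * (g * ↑u⁻¹) ^ j = 1 := by
    intro j
    induction j with
    | zero => simp
    | succ j ih => rw [pow_succ, pow_succ', mul_assoc, ← mul_assoc n, h1, one_mul, ih]
  have := h2 m
  rw [hm, zero_mul] at this
  exact zero_ne_one this

lemma isNilpotent_mul_left {n : R} (hn : IsNilpotent n) (g : R) : IsNilpotent (g * n) := by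
  obtain ⟨m, hm⟩ := h.isNilpotent_mul hn g
  refine ⟨m + 1, ?_⟩
  rw [mul_pow_eq_aux, hm]; simp
where
  mul_pow_eq_aux : ∀ {n g : R} {m : ℕ}, (g * n) ^ (m + 1) = g * (n * g) ^ m * n := by
    intro n g m
    induction m with
    | zero => simp
    | succ m ih => rw [pow_succ, ih, pow_succ]; simp only [mul_assoc]

lemma isNilpotent_add {n m : R} (hn : IsNilpotent n) (hm : IsNilpotent m) :
    IsNilpotent (n + m) := by
  refine (h.isNilpotent_or_isUnit _).resolve_right fun ⟨u, hu⟩ => ?_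
  have h1 : (↑u⁻¹ : R) * m = 1 - ↑u⁻¹ * n := by
    rw [eq_sub_iff_add_eq, ← mul_add, add_comm m, ← hu, Units.inv_mul]
  refine not_isUnit_of_isNilpotent (h.isNilpotent_mul_left hm (↑u⁻¹ : R)) ?_
  rw [h1]
  exact (h.isNilpotent_mul_left hn _).isUnit_one_sub

/-- The residue homomorphism to `k`. -/
lemma exists_residue : ∃ r : R →ₐ[k] k, ∀ f, r f ≠ 0 → IsUnit f := by
  choose c hc using id h
  have uniq : ∀ f d, IsNilpotent (f - algebraMap k R d) → d = c f := by
    intro f d hd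
    by_contra hne
    have := isUnit_algebraMap_add_of_isNilpotent (R := R) (sub_ne_zero.2 hne) hd
    refine not_isUnit_of_isNilpotent (hc f) ?_
    rw [map_sub] at this
    convert this using 1
    abel
  have hsm : ∀ n : R, ∀ d : k, IsNilpotent n → IsNilpotent (algebraMap k R d * n) := fun n d hn =>
    h.isNilpotent_mul_left hn _
  refine ⟨AlgHom.mk' ⟨⟨⟨c, ?_⟩, ?_⟩, ?_, ?_⟩ ?_, ?_⟩
  · exact (uniq _ _ (by simp)).symm
  · intro f g
    refine (uniq _ _ ?_).symm
    convert h.isNilpotent_add (h.isNilpotent_mul (hc f) g) (hsm _ (c f) (hc g)) using 1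
    simp only [map_mul]
    noncomm_ring
  · exact (uniq _ _ (by simp)).symm
  · intro f g
    refine (uniq _ _ ?_).symm
    convert h.isNilpotent_add (hc f) (hc g) using 1
    simp only [map_add]
    abel
  · intro d f
    refine (uniq _ _ ?_).symm
    convert hsm _ d (hc f) using 1
    simp [Algebra.smul_def, mul_sub]
  · intro f hf
    by_contra hu
    have := (h.isNilpotent_or_isUnit f).resolve_right hu
    exact hf (uniq f 0 (by simpa using this)).symm

end ScalarAddNilpotent

end SplitLocal

/-! ### Decompositions into indecomposables -/

section Decomposition

set_option linter.unusedSectionVars false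

variable {C : Type u} [Category.{v} C] [Preadditive C] [HasZeroObject C] [HasShift C ℤ]
  [∀ n : ℤ, (shiftFunctor C n).Additive] [Pretriangulated C]

namespace IndecDecomp

/-- The transport of a decomposition along an isomorphism. -/
def ofIso {X Y : C} (d : IndecDecomp X) (e : Y ≅ X) : IndecDecomp Y where
  n := d.n
  F := d.F
  indec := d.indec
  iso := e ≪≫ d.iso

/-- The summands are retracts. -/
def retract {X : C} (d : IndecDecomp X) (i : Fin d.n) : Retract (d.F i) X where
  i := biproduct.ι d.F i ≫ d.iso.inv
  r := d.iso.hom ≫ biproduct.π d.F i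

/-- The concatenation of decompositions of the terms of a biproduct. -/
def sum {X Y : C} (d : IndecDecomp X) (d' : IndecDecomp Y) : IndecDecomp (X ⊞ Y) where
  n := d.n + d'.n
  F := Fin.append d.F d'.F
  indec := fun i => by
    induction i using Fin.addCases with
    | left i => rw [Fin.append_left]; exact d.indec i
    | right i => rw [Fin.append_right]; exact d'.indec i
  iso :=
    let a (i : Fin d.n) : d.F i ≅ Fin.append d.F d'.F (Fin.castAdd _ i) :=
      eqToIso (Fin.append_left _ _ i).symm
    let b (i : Fin d'.n) : d'.F i ≅ Fin.append d.F d'.F (Fin.natAdd _ i) :=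
      eqToIso (Fin.append_right _ _ i).symm
    biprod.mapIso d.iso d'.iso ≪≫
    { hom := biprod.desc
        (biproduct.desc fun i => (a i).hom ≫ biproduct.ι (Fin.append d.F d'.F) _)
        (biproduct.desc fun i => (b i).hom ≫ biproduct.ι (Fin.append d.F d'.F) _)
      inv := biprod.lift
        (biproduct.lift fun i => biproduct.π (Fin.append d.F d'.F) _ ≫ (a i).inv)
        (biproduct.lift fun i => biproduct.π (Fin.append d.F d'.F) _ ≫ (b i).inv)
      hom_inv_id := by
        have hne : ∀ (i : Fin d.n) (j : Fin d'.n), Fin.castAdd d'.n i ≠ Fin.natAdd d.n j := by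
          intro i j h
          have := congrArg Fin.val h
          simp at this
          lia
        ext i j
        · by_cases hij : i = j
          · subst hij; simp
          · simp [biproduct.ι_π_ne_assoc _ (fun h => hij (Fin.castAdd_injective _ _ h)),
              biproduct.ι_π_ne _ hij]
        · simp [biproduct.ι_π_ne_assoc _ (hne i j)]
        · simp [biproduct.ι_π_ne_assoc _ (hne j i).symm]
        · by_cases hij : i = j
          · subst hij; simp
          · simp [biproduct.ι_π_ne_assoc _ (fun h => hij (Fin.natAdd_injective _ _ h)),
              biproduct.ι_π_ne _ hij]
      inv_hom_id := by
        rw [biprod.lift_desc, biproduct.lift_desc, biproduct.lift_desc, ← biproduct.total,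
          Fin.sum_univ_add]
        simp }

lemma sum_retract {X : C} (d : IndecDecomp X) :
    ∑ j, (d.retract j).r ≫ (d.retract j).i = 𝟙 X := by
  have h := congrArg (fun f => d.iso.hom ≫ f ≫ d.iso.inv) (biproduct.total (f := d.F))
  simp only [Preadditive.sum_comp, Preadditive.comp_sum] at h
  simpa only [Category.assoc, Category.id_comp, Iso.hom_inv_id, IndecDecomp.retract] using h

end IndecDecomp

lemma IsInd.exists_retract {X Y : C} (h : IsInd Y X) :
    Nonempty (Retract Y X) ∧ Indecomposable Y := by
  obtain ⟨d, i, ⟨e⟩⟩ := h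
  exact ⟨⟨(Retract.ofIso e).trans (d.retract i)⟩, fun h => (d.indec i).1 (h.of_iso e.symm),
    fun Z W f => (d.indec i).2 Z W (e.symm ≪≫ f)⟩

variable (k : Type t) [Field k] [Linear k C]

/-- Any two decompositions of `X` have the same number of summands isomorphic to `Y`: this number
is the dimension of the quotient of `Hom(Y, X)` by the morphisms whose compositions with all
morphisms `X ⟶ Y` have residue zero. -/
lemma IndecDecomp.card_eq {X Y : C} (hY : ¬ IsZero Y) (h : ScalarAddNilpotent k (End Y))
    (d d' : IndecDecomp X) :
    Nat.card {i : Fin d.n // Nonempty (Y ≅ d.F i)} =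
      Nat.card {i : Fin d'.n // Nonempty (Y ≅ d'.F i)} := by
  classical
  have : Nontrivial (End Y) := ⟨1, 0, fun h => hY ((IsZero.iff_id_eq_zero Y).2 h)⟩
  obtain ⟨r, hr⟩ := h.exists_residue
  have hr_comp : ∀ f g : Y ⟶ Y, r (f ≫ g : Y ⟶ Y) = r f * r g := fun f g => by
    rw [mul_comm]; exact map_mul (M := End Y) r g f
  have hr_id : r (𝟙 Y : Y ⟶ Y) = 1 := map_one r
  have hr_sum : ∀ {ι : Type} (s : Finset ι) (f : ι → (Y ⟶ Y)),
      r (∑ i ∈ s, f i : Y ⟶ Y) = ∑ i ∈ s, r (f i : Y ⟶ Y) := fun s f =>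
    map_sum r (fun i => (f i : End Y)) s
  have hr_smul : ∀ (c : k) (f : Y ⟶ Y), r (c • f : Y ⟶ Y) = c * r f := fun c f =>
    map_smul r c (f : End Y)
  suffices key : ∀ d : IndecDecomp X,
      ∃ L : (Y ⟶ X) →ₗ[k] ({i : Fin d.n // Nonempty (Y ≅ d.F i)} → k),
      Function.Surjective L ∧ ∀ f, f ∈ LinearMap.ker L ↔ ∀ g : X ⟶ Y, r (f ≫ g : Y ⟶ Y) = 0 by
    obtain ⟨L, hL, hker⟩ := key d
    obtain ⟨L', hL', hker'⟩ := key d'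
    have e := L.quotKerEquivOfSurjective hL
    have : LinearMap.ker L = LinearMap.ker L' := by
      ext f; rw [hker, hker']
    rw [this] at e
    have e' := L'.quotKerEquivOfSurjective hL'
    have := (e.symm.trans e').finrank_eq
    simpa only [Module.finrank_fintype_fun_eq_card, ← Nat.card_eq_fintype_card] using this
  intro d
  let e (i : {i : Fin d.n // Nonempty (Y ≅ d.F i)}) : Y ≅ d.F i := i.2.some
  refine ⟨{ toFun := fun f i => r (f ≫ (d.retract i).r ≫ (e i).inv : Y ⟶ Y)
            map_add' := fun f g => funext fun i => by
              rw [Preadditive.add_comp]; exact map_add r _ _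
            map_smul' := fun c f => funext fun i => by
              rw [Linear.smul_comp]; exact hr_smul _ _ }, ?_, ?_⟩
  · intro v
    refine ⟨∑ i, v i • ((e i).hom ≫ (d.retract i).i), funext fun j => ?_⟩
    change r ((∑ i, v i • ((e i).hom ≫ (d.retract i).i)) ≫ (d.retract j).r ≫ (e j).inv : Y ⟶ Y) = _
    rw [Preadditive.sum_comp, hr_sum, Finset.sum_eq_single j]
    · rw [Linear.smul_comp, hr_smul, Category.assoc, (d.retract j).retract_assoc, Iso.hom_inv_id,
        hr_id, mul_one]
    · intro i _ hij
      have : (d.retract i).i ≫ (d.retract j).r = 0 := by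
        simp [retract, biproduct.ι_π_ne _ (fun h => hij (Subtype.ext h))]
      rw [Linear.smul_comp, hr_smul, Category.assoc, reassoc_of% this, zero_comp, comp_zero]
      exact mul_eq_zero_of_right _ (map_zero r)
    · simp
  · intro f
    constructor
    · intro hf g
      have : f ≫ g = ∑ i, f ≫ (d.retract i).r ≫ (d.retract i).i ≫ g := by
        conv_lhs => rw [← Category.comp_id f, ← d.sum_retract]
        simp [Preadditive.sum_comp, Preadditive.comp_sum]
      rw [this, hr_sum]
      refine Finset.sum_eq_zero fun i _ => ?_
      by_cases hi : Nonempty (Y ≅ d.F i)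
      · have h0 : r (f ≫ (d.retract i).r ≫ (e ⟨i, hi⟩).inv : Y ⟶ Y) = 0 := congrFun hf ⟨i, hi⟩
        have : f ≫ (d.retract i).r ≫ (d.retract i).i ≫ g =
            (f ≫ (d.retract i).r ≫ (e ⟨i, hi⟩).inv) ≫ ((e ⟨i, hi⟩).hom ≫ (d.retract i).i ≫ g) := by
          simp
        rw [this, hr_comp, h0, zero_mul]
      · by_contra hne
        -- a unit that factors through `d.F i` makes `Y` a summand of the indecomposable `d.F i`
        obtain ⟨u, hu⟩ := hr _ hne
        have hu' : f ≫ (d.retract i).r ≫ (d.retract i).i ≫ g = (u.val : End Y) := hu.symm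
        have : (f ≫ (d.retract i).r) ≫ ((d.retract i).i ≫ g ≫ (u⁻¹.val : End Y)) = 𝟙 Y := by
          have h2 : (u.val : Y ⟶ Y) ≫ (u⁻¹.val : End Y) = 𝟙 Y := Units.inv_mul u
          rw [← h2, ← hu']
          simp
        exact hi (Indecomposable.iso_of_retract (d.indec i) ⟨_, _, this⟩ hY)
    · intro hf
      exact funext fun i => hf _

variable {k}

lemma multiplicity_eq {X Y : C} (hY : ¬ IsZero Y) (h : ScalarAddNilpotent k (End Y))
    (d : IndecDecomp X) : multiplicity X Y = Nat.card {i : Fin d.n // Nonempty (Y ≅ d.F i)} := by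
  have hd : Nonempty (IndecDecomp X) := ⟨d⟩
  rw [multiplicity, dif_pos hd]
  exact IndecDecomp.card_eq k hY h _ _

variable (k) (C) in
/-- `C` is a Krull-Schmidt category all of whose indecomposable objects have endomorphism rings
with residue field `k`. -/
structure KrullSchmidt : Prop where
  decomp : ∀ X : C, Nonempty (IndecDecomp X)
  local_end : ∀ Y : C, Indecomposable Y → ScalarAddNilpotent k (End Y)

namespace KrullSchmidt

variable (hC : KrullSchmidt C k) {Y : C} (hY : Indecomposable Y)
include hC hY

lemma multiplicity_iso {X X' : C} (e : X ≅ X') : multiplicity X Y = multiplicity X' Y := by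
  obtain ⟨d⟩ := hC.decomp X'
  rw [multiplicity_eq hY.1 (hC.local_end Y hY) d,
    multiplicity_eq hY.1 (hC.local_end Y hY) (d.ofIso e)]
  rfl

lemma multiplicity_biprod (X X' : C) :
    multiplicity (X ⊞ X') Y = multiplicity X Y + multiplicity X' Y := by
  obtain ⟨d⟩ := hC.decomp X
  obtain ⟨d'⟩ := hC.decomp X'
  rw [multiplicity_eq hY.1 (hC.local_end Y hY) d, multiplicity_eq hY.1 (hC.local_end Y hY) d',
    multiplicity_eq hY.1 (hC.local_end Y hY) (d.sum d'), ← Nat.card_sum]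
  refine Nat.card_congr ((finSumFinEquiv.symm.subtypeEquiv (q := fun s => Sum.elim
    (fun i => Nonempty (Y ≅ d.F i)) (fun i => Nonempty (Y ≅ d'.F i)) s) fun i => ?_).trans
    Equiv.subtypeSum)
  induction i using Fin.addCases with
  | left i => simp [IndecDecomp.sum]
  | right i => simp [IndecDecomp.sum]

lemma multiplicity_of_isZero {X : C} (hX : IsZero X) : multiplicity X Y = 0 := by
  have h := hC.multiplicity_biprod hY X X
  have e : X ⊞ X ≅ X := IsZero.iso ((IsZero.iff_id_eq_zero _).2
    (by ext <;> exact hX.eq_of_tgt _ _)) hX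
  rw [hC.multiplicity_iso hY e] at h
  lia

omit hY in
/-- A nonzero object has an indecomposable summand, which has nonzero multiplicity. -/
lemma exists_multiplicity_pos {X : C} (hX : ¬ IsZero X) :
    ∃ Y, Indecomposable Y ∧ Nonempty (Retract Y X) ∧ 0 < multiplicity X Y := by
  obtain ⟨d⟩ := hC.decomp X
  have hn : d.n ≠ 0 := by
    intro h0
    apply hX
    refine IsZero.of_iso ((IsZero.iff_id_eq_zero _).2 ?_) d.iso
    refine biproduct.hom_ext _ _ fun i => ?_
    exact (Fin.cast h0 i).elim0
  let i : Fin d.n := ⟨0, Nat.pos_of_ne_zero hn⟩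
  refine ⟨d.F i, d.indec i, ⟨d.retract i⟩, ?_⟩
  rw [multiplicity_eq (d.indec i).1 (hC.local_end _ (d.indec i)) d]
  have : Nonempty {j : Fin d.n // Nonempty (d.F i ≅ d.F j)} := ⟨⟨i, ⟨Iso.refl _⟩⟩⟩
  exact Nat.card_pos

end KrullSchmidt

end Decomposition

/-! ### The function `θ_σ` -/

section Theta

open ZeroObject

set_option linter.unusedSectionVars false

variable {C : Type u} [Category.{v} C] [Preadditive C] [HasZeroObject C] [HasShift C ℤ]
  [∀ n : ℤ, (shiftFunctor C n).Additive] [Pretriangulated C]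

namespace StabilityCondition

variable (σ : StabilityCondition C)

/-- `X` has a Harder-Narasimhan filtration the factors of which have the summands counted by `m`.
This is an inductive form of `HNFiltration`, which remembers the multiplicities only. -/
inductive Counts : (σ.IndecSemistable → ℕ) → C → Prop
  | zero (X : C) (hX : IsZero X) : Counts 0 X
  | step (t : ℝ) (U X V : C) (f : U ⟶ X) (g : X ⟶ V) (h : V ⟶ U⟦(1 : ℤ)⟧)
      (hT : Triangle.mk f g h ∈ distTriang C) (m : σ.IndecSemistable → ℕ) (hm : Counts m U)
      (hU : σ.Gt t U) (hV : σ.P t V) (hV₀ : ¬ IsZero V) :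
      Counts (fun Y => m Y + multiplicity V Y.1) X

variable {σ}

lemma Counts.of_iso {m : σ.IndecSemistable → ℕ} {X X' : C} (e : X ≅ X') (h : σ.Counts m X) :
    σ.Counts m X' := by
  cases h with
  | zero _ hX => exact .zero _ (hX.of_iso e.symm)
  | step t U _ V f g h hT m hm hU hV hV₀ =>
    refine .step t U X' V (f ≫ e.hom) (e.inv ≫ g) h ?_ m hm hU hV hV₀
    simpa using distinguished_of_isos hT (Iso.refl _) e (Iso.refl _)

/-- The part of a Harder-Narasimhan filtration below the index `i` counts the factors before it. -/
lemma counts_hn_E (X : C) (hX : ¬ IsZero X) (i : Fin ((σ.hn X hX).n + 2)) :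
    σ.Counts (fun Y => ∑ j : Fin ((σ.hn X hX).n + 1),
      if j.castSucc < i then multiplicity ((σ.hn X hX).A j) Y.1 else 0) ((σ.hn X hX).E i) := by
  induction i using Fin.induction with
  | zero => simpa using! Counts.zero _ (σ.hn X hX).isZero
  | succ i ih =>
    convert Counts.step _ _ _ _ _ _ _ ((σ.hn X hX).dist i) _ ih (hn_gt X hX i)
      ((σ.hn X hX).mem i) ((σ.hn X hX).nonzero i) using 2 with Y
    have : ∀ j : Fin ((σ.hn X hX).n + 1),
        (if j.castSucc < i.succ then multiplicity ((σ.hn X hX).A j) Y.1 else 0) =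
        (if j.castSucc < i.castSucc then multiplicity ((σ.hn X hX).A j) Y.1 else 0) +
        (if j = i then multiplicity ((σ.hn X hX).A j) Y.1 else 0) := by
      intro j
      have h1 : j.castSucc < i.succ ↔ j < i ∨ j = i := by
        simp only [Fin.lt_def, Fin.ext_iff, Fin.val_castSucc, Fin.val_succ]; lia
      have h2 : j.castSucc < i.castSucc ↔ j < i := by simp
      by_cases hj : j = i
      · subst hj; simp
      · simp [h1, hj]
    rw [Finset.sum_congr rfl fun j _ => this j, Finset.sum_add_distrib]
    simp

lemma counts_theta (X : C) : σ.Counts (σ.theta X) X := by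
  by_cases hX : IsZero X
  · have : σ.theta X = 0 := funext fun Y => by simp [theta, hX]
    rw [this]
    exact .zero X hX
  · refine Counts.of_iso (σ.hn X hX).top ?_
    have : σ.theta X = _ := funext fun Y => by simp only [theta, dif_neg hX]; rfl
    rw [this]
    simpa using! counts_hn_E X hX (Fin.last _)

variable {k : Type t} [Field k] [Linear k C] (hC : KrullSchmidt C k)
include hC

/-- The multiplicities do not depend on the filtration: the last triangles of two filtrations of the
same object are isomorphic, as there are no morphisms from `P(> t)` to `P(t)`. -/
lemma Counts.unique {m m' : σ.IndecSemistable → ℕ} {X X' : C} (h : σ.Counts m X)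
    (h' : σ.Counts m' X') (e : X ≅ X') : m = m' := by
  have not_zero : ∀ (t : ℝ) (U X V : C) (f : U ⟶ X) (g : X ⟶ V) (h : V ⟶ U⟦(1 : ℤ)⟧)
      (_ : Triangle.mk f g h ∈ distTriang C) (_ : σ.Gt t U) (_ : σ.P t V) (_ : ¬ IsZero V),
      ¬ IsZero X := fun t U X V f g h hT hU hV hV₀ hX =>
    mor₂_ne_zero_of_homVanish hT (hU.homVanish_of_nonpos hV (by lia)) hV₀ (hX.eq_of_src g 0)
  induction h generalizing m' X' with
  | zero X hX =>
    cases h' with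
    | zero => rfl
    | step t U _ V f g h hT m hm hU hV hV₀ =>
      exact (not_zero t U X' V f g h hT hU hV hV₀ (hX.of_iso e.symm)).elim
  | step t U X V f g h hT m hm hU hV hV₀ ih =>
    cases h' with
    | zero _ hX => exact (not_zero t U X V f g h hT hU hV hV₀ (hX.of_iso e)).elim
    | step t' U' _ V' f' g' h' hT' m' hm' hU' hV' hV₀' =>
      have htt : t = t' := by
        have g1 : σ.Ge t X := Ge.ext hT hU.ge (ge_of_mem hV le_rfl)
        have g2 : σ.Ge t' X' := Ge.ext hT' hU'.ge (ge_of_mem hV' le_rfl)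
        rcases lt_trichotomy t t' with hlt | heq | hlt
        · exact (mor₂_ne_zero_of_homVanish hT (hU.homVanish_of_nonpos hV (by lia)) hV₀
            ((g2.of_retract (.ofIso e)) t hlt V hV g)).elim
        · exact heq
        · exact (mor₂_ne_zero_of_homVanish hT' (hU'.homVanish_of_nonpos hV' (by lia)) hV₀'
            ((g1.of_retract (.ofIso e.symm)) t' hlt V' hV' g')).elim
      subst htt
      obtain ⟨⟨e₁⟩, ⟨e₃⟩⟩ := triangle_iso_of_noHom hT hT' e (by
        intro i hi A hA B hB
        have hi' : (i : ℝ) ≤ 0 := by exact_mod_cast hi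
        have hA' : σ.Gt t A := by
          simp only [List.mem_cons, List.not_mem_nil, or_false] at hA
          obtain rfl | rfl := hA
          exacts [hU, hU']
        have hB' : σ.P t B := by
          simp only [List.mem_cons, List.not_mem_nil, or_false] at hB
          obtain rfl | rfl := hB
          exacts [hV, hV']
        exact hA'.homVanish hB' i (by linarith))
      have h1 : m = m' := ih hm' e₁
      subst h1
      funext Y
      have := hC.multiplicity_iso Y.2.2 e₃
      change multiplicity V Y.1 = multiplicity V' Y.1 at this
      rw [this]

lemma Counts.theta_eq {m : σ.IndecSemistable → ℕ} {X : C} (h : σ.Counts m X) : σ.theta X = m :=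
  (counts_theta X).unique hC h (Iso.refl X)

lemma theta_iso {X X' : C} (e : X ≅ X') : σ.theta X = σ.theta X' :=
  (counts_theta X).unique hC (counts_theta X') e

/-- `θ_σ` is additive on the triangles that split off the last Harder-Narasimhan factor. -/
lemma theta_eq_add {t : ℝ} {T : Triangle C} (hT : T ∈ distTriang C) (h₁ : σ.Gt t T.obj₁)
    (h₃ : σ.P t T.obj₃) (Y : σ.IndecSemistable) :
    σ.theta T.obj₂ Y = σ.theta T.obj₁ Y + multiplicity T.obj₃ Y.1 := by
  by_cases hV : IsZero T.obj₃
  · have := (Triangle.isZero₃_iff_isIso₁ _ hT).1 hV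
    rw [hC.multiplicity_of_isZero Y.2.2 hV, add_zero, theta_iso hC (asIso T.mor₁)]
  · exact congrFun ((Counts.step t _ _ _ T.mor₁ T.mor₂ T.mor₃ hT _ (counts_theta _) h₁ h₃
      hV).theta_eq hC) Y

/-- `θ_σ` is additive on direct sums: two Harder-Narasimhan filtrations are merged by always
splitting off the factor of smaller phase. -/
lemma Counts.biprod {m m' : σ.IndecSemistable → ℕ} {X X' : C} (h : σ.Counts m X)
    (h' : σ.Counts m' X') : σ.Counts (m + m') (X ⊞ X') := by
  have zero_left : ∀ {X X' : C}, IsZero X → Nonempty (X' ≅ X ⊞ X') := fun {X X'} hX =>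
    ⟨{ hom := biprod.inr
       inv := biprod.snd
       inv_hom_id := by
        ext
        · exact hX.eq_of_src _ _
        · exact hX.eq_of_src _ _
        · simp
        · simp }⟩
  have triv : ∀ X : C, Triangle.mk (𝟙 X) (0 : X ⟶ 0) 0 ∈ distTriang C :=
    contractible_distinguished
  induction h generalizing m' X' with
  | zero X hX =>
    rw [zero_add]
    exact h'.of_iso (zero_left hX).some
  | step t U X V f g h hT m hm hU hV hV₀ ih =>
    induction h' with
    | zero X' hX' =>
      rw [add_zero]
      exact (Counts.step t U X V f g h hT m hm hU hV hV₀).of_iso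
        ((zero_left hX').some ≪≫ biprod.braiding _ _)
    | step t' U' X' V' f' g' h' hT' m' hm' hU' hV' hV₀' ih' =>
      have g1 : σ.Ge t X := Ge.ext hT hU.ge (ge_of_mem hV le_rfl)
      have g2 : σ.Ge t' X' := Ge.ext hT' hU'.ge (ge_of_mem hV' le_rfl)
      rcases lt_trichotomy t t' with hlt | rfl | hlt
      · obtain ⟨S, hS, ⟨e₁⟩, ⟨e₂⟩, ⟨e₃⟩⟩ := exists_sum_triangle hT (triv X')
        have e₃' : S.obj₃ ≅ V := e₃ ≪≫ biprod.braiding _ _ ≪≫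
          (zero_left (isZero_zero C)).some.symm
        have := Counts.step t _ _ _ _ _ _ hS _
          ((ih (Counts.step t' U' X' V' f' g' h' hT' m' hm' hU' hV' hV₀')).of_iso e₁.symm)
          ((hU.biprod (g2.gt hlt)).of_retract (.ofIso e₁))
          (mem_of_iso e₃'.symm hV) (fun h => hV₀ (h.of_iso e₃'.symm))
        refine Counts.of_iso e₂ ?_
        convert this using 1
        funext Y
        rw [hC.multiplicity_iso Y.2.2 e₃']
        simp only [Pi.add_apply]
        lia
      · obtain ⟨S, hS, ⟨e₁⟩, ⟨e₂⟩, ⟨e₃⟩⟩ := exists_sum_triangle hT hT'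
        have := Counts.step t _ _ _ _ _ _ hS _
          ((ih hm').of_iso e₁.symm)
          ((hU.biprod hU').of_retract (.ofIso e₁))
          (mem_of_iso e₃.symm (σ.biprod_mem t _ _ hV hV'))
          (fun h => hV₀ (isZero_of_retract (retractLeft V V') (h.of_iso e₃.symm)))
        refine Counts.of_iso e₂ ?_
        convert this using 1
        funext Y
        rw [hC.multiplicity_iso Y.2.2 e₃, hC.multiplicity_biprod Y.2.2]
        simp only [Pi.add_apply, Triangle.mk_obj₃]
        lia
      · obtain ⟨S, hS, ⟨e₁⟩, ⟨e₂⟩, ⟨e₃⟩⟩ := exists_sum_triangle (triv X) hT'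
        have e₃' : S.obj₃ ≅ V' := e₃ ≪≫ (zero_left (isZero_zero C)).some.symm
        have := Counts.step t' _ _ _ _ _ _ hS _ (ih'.of_iso e₁.symm)
          (((g1.gt hlt).biprod hU').of_retract (.ofIso e₁))
          (mem_of_iso e₃'.symm hV') (fun h => hV₀' (h.of_iso e₃'.symm))
        refine Counts.of_iso e₂ ?_
        convert this using 1
        funext Y
        rw [hC.multiplicity_iso Y.2.2 e₃']
        simp only [Pi.add_apply]
        lia

lemma theta_biprod (X X' : C) : σ.theta (X ⊞ X') = σ.theta X + σ.theta X' :=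
  ((counts_theta X).biprod hC (counts_theta X')).theta_eq hC

end StabilityCondition

end Theta

/-! ### The embedding of `A` into the bounded derived category -/

section Db

variable {A : Type u} [Category.{v} A] [Abelian A] [HasDerivedCategory.{w} A]

/-- The canonical t-structure on the bounded derived category. -/
abbrev tStr : Triangulated.TStructure (Db A) := DerivedCategory.TStructure.t.onBounded

/-- The inclusion of the bounded derived category into the derived category. -/
abbrev incl : Db A ⥤ DerivedCategory A := DerivedCategory.Bounded.ι

lemma incl_map_emb_map {X Y : A} (f : X ⟶ Y) :
    incl.map ((emb A).map f) = (DerivedCategory.singleFunctor A 0).map f := rfl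

instance : (emb A).Full where
  map_surjective f := by
    obtain ⟨g, hg⟩ := (DerivedCategory.singleFunctor A 0).map_surjective (incl.map f)
    exact ⟨g, incl.map_injective hg⟩

instance : (emb A).Faithful where
  map_injective {X Y f g} h := (DerivedCategory.singleFunctor A 0).map_injective
    (by rw [← incl_map_emb_map, h, incl_map_emb_map])

instance : (emb A).Additive where
  map_add {X Y f g} := incl.map_injective (by
    rw [incl_map_emb_map, Functor.map_add, Functor.map_add]; rfl)

instance isLE_emb (X : A) : tStr.IsLE ((emb A).obj X) 0 := by
  rw [ObjectProperty.tStructure_isLE_iff]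
  exact inferInstanceAs (((DerivedCategory.singleFunctor A 0).obj X).IsLE 0)

instance isGE_emb (X : A) : tStr.IsGE ((emb A).obj X) 0 := by
  rw [ObjectProperty.tStructure_isGE_iff]
  exact inferInstanceAs (((DerivedCategory.singleFunctor A 0).obj X).IsGE 0)

lemma homVanish_emb_of_neg (X Y : A) {i : ℤ} (hi : i < 0) :
    HomVanish ((emb A).obj X) ((emb A).obj Y) i := by
  intro f
  have := tStr.isGE_shift ((emb A).obj Y) 0 i (-i)
  exact tStr.zero f 0 (-i) (by lia)

/-- The heart of the canonical t-structure is `A`. -/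
lemma exists_iso_emb (X : Db A) [tStr.IsLE X 0] [tStr.IsGE X 0] :
    ∃ Y : A, Nonempty (X ≅ (emb A).obj Y) := by
  have h1 : X.obj.IsLE 0 := (ObjectProperty.tStructure_isLE_iff _ _ X 0).1 inferInstance
  have h2 : X.obj.IsGE 0 := (ObjectProperty.tStructure_isGE_iff _ _ X 0).1 inferInstance
  obtain ⟨Y, ⟨e⟩⟩ := X.obj.exists_iso_singleFunctor_obj_of_isGE_of_isLE 0
  exact ⟨Y, ⟨ObjectProperty.isoMk _ e⟩⟩

/-- A short exact sequence in `A` gives a distinguished triangle in the bounded derived category. -/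
lemma exists_triangle_of_shortExact {S : ShortComplex A} (hS : S.ShortExact) :
    ∃ h, Triangle.mk ((emb A).map S.f) ((emb A).map S.g) h ∈ distTriang (Db A) := by
  let δ : incl.obj ((emb A).obj S.X₃) ⟶ (incl.obj ((emb A).obj S.X₁))⟦(1 : ℤ)⟧ := hS.singleδ
  obtain ⟨g, hg⟩ := incl.map_surjective
    (δ ≫ (incl.commShiftIso (1 : ℤ)).inv.app ((emb A).obj S.X₁))
  have h : incl.map g ≫ (incl.commShiftIso (1 : ℤ)).hom.app ((emb A).obj S.X₁) = δ := by
    rw [hg, Category.assoc, Iso.inv_hom_id_app]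
    exact Category.comp_id _
  refine ⟨g, isomorphic_distinguished _ hS.singleTriangle_distinguished _ ?_⟩
  refine Triangle.isoMk _ _ (Iso.refl _) (Iso.refl _) (Iso.refl _) ?_ ?_ ?_
  · exact (Category.comp_id _).trans (Category.id_comp _).symm
  · exact (Category.comp_id _).trans (Category.id_comp _).symm
  · change (incl.map g ≫ (incl.commShiftIso (1 : ℤ)).hom.app ((emb A).obj S.X₁)) ≫
      (shiftFunctor _ (1 : ℤ)).map (𝟙 _) = 𝟙 _ ≫ δ
    rw [h, CategoryTheory.Functor.map_id]
    exact (Category.comp_id _).trans (Category.id_comp _).symm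

variable (k : Type t) [Field k] [Linear k A]

instance : (emb A).Linear k where
  map_smul f c :=
    incl.map_injective (by
      rw [incl_map_emb_map, Functor.map_smul, Functor.map_smul]; rfl)

instance (n : ℤ) : (shiftFunctor (Db A) n).Linear k where
  map_smul {X Y} f c := incl.map_injective (by
    rw [← cancel_mono ((incl.commShiftIso n).hom.app Y), incl.commShiftIso_hom_naturality,
      Functor.map_smul, Functor.map_smul, Linear.comp_smul, Functor.map_smul, Linear.smul_comp,
      incl.commShiftIso_hom_naturality])

end Db

/-! ### Objects of the bounded derived category of a hereditary category -/

section Structure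

open ZeroObject

variable {A : Type u} [Category.{v} A] [Abelian A] [HasDerivedCategory.{w} A]

lemma nonempty_map_biprod_iso {C D : Type*} [Category* C] [Category* D] [Preadditive C]
    [Preadditive D] [HasBinaryBiproducts C] [HasBinaryBiproducts D] (F : C ⥤ D) [F.Additive]
    (X Y : C) : Nonempty (F.obj (X ⊞ Y) ≅ F.obj X ⊞ F.obj Y) :=
  ⟨{ hom := biprod.lift (F.map biprod.fst) (F.map biprod.snd)
     inv := biprod.desc (F.map biprod.inl) (F.map biprod.inr)
     hom_inv_id := by
      rw [biprod.lift_desc, ← F.map_comp, ← F.map_comp, ← F.map_add, biprod.total, F.map_id]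
     inv_hom_id := by ext <;> simp [← F.map_comp] }⟩

lemma exists_iso_emb_of_triangle {T : Triangle (Db A)} (hT : T ∈ distTriang (Db A)) {X Z : A}
    (e₁ : T.obj₁ ≅ (emb A).obj X) (e₃ : T.obj₃ ≅ (emb A).obj Z) :
    ∃ Y : A, Nonempty (T.obj₂ ≅ (emb A).obj Y) := by
  have := tStr.isLE₂ T hT 0 (tStr.isLE_of_iso e₁.symm 0) (tStr.isLE_of_iso e₃.symm 0)
  have := tStr.isGE₂ T hT 0 (tStr.isGE_of_iso e₁.symm 0) (tStr.isGE_of_iso e₃.symm 0)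
  exact exists_iso_emb T.obj₂

/-- A retract of a shift of an object of `A` is of the same form. -/
lemma exists_iso_of_retract_emb_shift {Y : Db A} {M : A} {n : ℤ}
    (r : Retract Y (((emb A).obj M)⟦n⟧)) :
    ∃ X : A, Nonempty (Retract X M) ∧ Nonempty (Y ≅ ((emb A).obj X)⟦n⟧) := by
  let F := emb A ⋙ shiftFunctor (Db A) n
  obtain ⟨e, he⟩ := F.map_surjective (r.r ≫ r.i)
  obtain ⟨X, i, p, hip, hpi⟩ := IsIdempotentComplete.idempotents_split M e
    (F.map_injective (by rw [F.map_comp, he]; simp))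
  refine ⟨X, ⟨⟨i, p, hip⟩⟩, ⟨⟨r.i ≫ F.map p, F.map i ≫ r.r, ?_, ?_⟩⟩⟩
  · rw [Category.assoc, ← F.map_comp_assoc, hpi, he]
    simp
  · have : r.r ≫ r.i = F.map e := he.symm
    rw [Category.assoc, reassoc_of% this, ← F.map_comp, ← F.map_comp, ← hpi, Category.assoc,
      reassoc_of% hip, hip]
    exact F.map_id X

lemma exists_iso_of_retract_emb {Y : Db A} {M : A} (r : Retract Y ((emb A).obj M)) :
    ∃ X : A, Nonempty (Retract X M) ∧ Nonempty (Y ≅ (emb A).obj X) := by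
  have e : ∀ Y : Db A, Y⟦(0 : ℤ)⟧ ≅ Y := fun Y => (shiftFunctorZero (Db A) ℤ).app Y
  obtain ⟨X, hX, ⟨f⟩⟩ := exists_iso_of_retract_emb_shift (n := 0)
    (r.trans (.ofIso (e _).symm))
  exact ⟨X, hX, ⟨f ≪≫ e _⟩⟩

lemma isZero_emb_iff {X : A} : IsZero ((emb A).obj X) ↔ IsZero X :=
  ⟨fun h => (IsZero.iff_id_eq_zero X).2 ((emb A).map_injective (h.eq_of_src _ _)),
    fun h => (emb A).map_isZero h⟩

/-- `X` is a finite direct sum of shifts `M⟦-j⟧`, with `j ≤ c`, of objects of `A`. -/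
inductive IsSumOfShifts : ℤ → Db A → Prop
  | zero (c : ℤ) (X : Db A) (hX : IsZero X) : IsSumOfShifts c X
  | step (c : ℤ) (X X' : Db A) (M : A) (e : X' ≅ X ⊞ ((emb A).obj M)⟦-c⟧)
      (hX : IsSumOfShifts (c - 1) X) : IsSumOfShifts c X'

variable (hher : Hereditary A)
include hher

/-- In particular `Hom(N[-c-1], X[1]) = 0`: this is the extension group in which the next truncation
triangle is classified. -/
lemma IsSumOfShifts.homVanish {c : ℤ} {X : Db A} (h : IsSumOfShifts c X) (N : A) (i : ℤ)
    (hi : c + 2 ≤ i) : HomVanish ((emb A).obj N) X i := by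
  induction h with
  | zero c X hX => exact fun f => ((shiftFunctor _ i).map_isZero hX).eq_of_tgt f 0
  | step c X X' M e hX ih =>
    refine HomVanish.of_iso (Iso.refl _) e ?_
    exact homVanish_to₂ (binaryBiproductTriangle_distinguished X _) i (ih (by lia))
      ((homVanish_shift_right_iff (-c) i (i - c) (by lia)).2 (hher _ _ _ (by lia)))

/-- Every object of the bounded derived category of a hereditary abelian category is a direct sum
of shifts of objects of `A`. -/
lemma exists_isSumOfShifts (X : Db A) : ∃ c, IsSumOfShifts c X := by
  -- induction on the amplitude `n`: the truncation triangle at the top degree splits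
  have key : ∀ (n : ℕ) (a : ℤ) (X : Db A), tStr.IsGE X a → tStr.IsLE X (a + n - 1) →
      IsSumOfShifts (a + n - 1) X := by
    intro n
    induction n with
    | zero =>
      intro a X _ _
      exact .zero _ _ (tStr.isZero X (a + (0 : ℕ) - 1) a (by simp))
    | succ n ih =>
      intro a X _ _
      obtain ⟨U, V, hU, hV, f, g, h, hT⟩ :=
        tStr.exists_triangle X (a + n - 1) (a + n) (by lia)
      have : tStr.IsLE U (a + n - 1) := ⟨hU⟩
      have : tStr.IsGE V (a + n) := ⟨hV⟩
      have : tStr.IsGE U a := by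
        have := tStr.isGE_shift V (a + n) (-1) (a + n + 1)
        exact tStr.isGE₂ _ (inv_rot_of_distTriang _ hT) a
          (tStr.isGE_of_ge (V⟦(-1 : ℤ)⟧) a (a + n + 1) (by lia)) (by assumption)
      have : tStr.IsLE V (a + n) := by
        have := tStr.isLE_shift U (a + n - 1) 1 (a + n - 2)
        exact tStr.isLE₂ _ (rot_of_distTriang _ hT) (a + n)
          (tStr.isLE_of_le X (a + (n + 1 : ℕ) - 1) _ (by lia))
          (tStr.isLE_of_le (U⟦(1 : ℤ)⟧) (a + n - 2) (a + n) (by lia))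
      have hUs := ih a U inferInstance inferInstance
      have := tStr.isLE_shift V (a + n) (a + n) 0
      have := tStr.isGE_shift V (a + n) (a + n) 0
      obtain ⟨M, ⟨e⟩⟩ := exists_iso_emb (V⟦a + n⟧)
      have e' : V ≅ ((emb A).obj M)⟦-(a + n : ℤ)⟧ :=
        (shiftFunctorCompIsoId (Db A) (a + n : ℤ) (-(a + n : ℤ)) (by simp)).symm.app V ≪≫
          (shiftFunctor _ (-(a + n : ℤ))).mapIso e
      have hh : h = 0 := by
        refine HomVanish.of_iso (X := ((emb A).obj M)⟦-(a + n : ℤ)⟧) e' (Iso.refl U) ?_ h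
        exact (homVanish_shift_left_iff (-(a + n : ℤ)) 1 (a + n + 1) (by lia)).2
          (hUs.homVanish hher M _ (by lia))
      obtain ⟨e₂, -⟩ := exists_iso_binaryBiproduct_of_distTriang _ hT hh
      have : a + (n + 1 : ℕ) - 1 = a + n := by push_cast; ring
      rw [this]
      exact .step _ U X M (e₂ ≪≫ biprod.mapIso (Iso.refl U) e') hUs
  obtain ⟨⟨a, ha⟩, ⟨b, hb⟩⟩ := X.property
  have h1 : tStr.IsGE X a := (ObjectProperty.tStructure_isGE_iff _ _ X a).2 ha
  have h2 : tStr.IsLE X b := (ObjectProperty.tStructure_isLE_iff _ _ X b).2 hb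
  obtain ⟨n, hn⟩ := Int.eq_ofNat_of_zero_le (a := max b a - a + 1) (by lia)
  refine ⟨_, key n a X h1 (tStr.isLE_of_le X b _ (by lia))⟩

/-- An object all of whose summands in `A[j]` with `j ≠ 0, 1` vanish lies in `A ⊕ A[1]`. -/
lemma exists_iso_biprod_shift (X : Db A)
    (h : ∀ (M : A) (j : ℤ), Nonempty (Retract (((emb A).obj M)⟦j⟧) X) → ¬ IsZero M →
      j = 0 ∨ j = 1) :
    ∃ B₀ B₁ : A, Nonempty (X ≅ (emb A).obj B₀ ⊞ ((emb A).obj B₁)⟦(1 : ℤ)⟧) := by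
  obtain ⟨c, hc⟩ := exists_isSumOfShifts hher X
  clear hher
  induction hc with
  | zero c X hX =>
    have h0 : IsZero ((emb A).obj (0 : A)) := isZero_emb_iff.2 (isZero_zero A)
    refine ⟨0, 0, ⟨hX.iso (isZero_of_noHom_self (noHom_biprod_left
      (fun f => h0.eq_of_src f 0) fun f => ?_))⟩⟩
    exact ((shiftFunctor _ (1 : ℤ)).map_isZero h0).eq_of_src f 0
  | step c X X' M e hX ih =>
    obtain ⟨B₀, B₁, ⟨f⟩⟩ := ih fun N j ⟨r⟩ => h N j
      ⟨r.trans ((retractLeft _ _).trans (.ofIso e.symm))⟩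
    by_cases hM : IsZero M
    · have hM' : IsZero (((emb A).obj M)⟦-c⟧) :=
        (shiftFunctor _ (-c)).map_isZero (isZero_emb_iff.2 hM)
      have : IsIso (biprod.inl : X ⟶ X ⊞ ((emb A).obj M)⟦-c⟧) :=
        (Biprod.isIso_inl_iff_isZero _ _).2 hM'
      exact ⟨B₀, B₁, ⟨e ≪≫ (asIso biprod.inl).symm ≪≫ f⟩⟩
    · obtain hj | hj := h M (-c) ⟨(retractRight _ _).trans (.ofIso e.symm)⟩ hM
      · have a : (emb A).obj (B₀ ⊞ M) ≅ (emb A).obj B₀ ⊞ ((emb A).obj M)⟦-c⟧ :=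
          (nonempty_map_biprod_iso (emb A) B₀ M).some ≪≫ biprod.mapIso (Iso.refl _)
            ((shiftFunctorZero' (Db A) (-c) hj).symm.app _)
        refine ⟨B₀ ⊞ M, B₁, ⟨e ≪≫ biprod.mapIso f (Iso.refl _) ≪≫ ?_⟩⟩
        exact biprod.associator _ _ _ ≪≫ biprod.mapIso (Iso.refl _) (biprod.braiding _ _) ≪≫
          (biprod.associator _ _ _).symm ≪≫ biprod.mapIso a.symm (Iso.refl _)
      · have a : ((emb A).obj (B₁ ⊞ M))⟦(1 : ℤ)⟧ ≅
            ((emb A).obj B₁)⟦(1 : ℤ)⟧ ⊞ ((emb A).obj M)⟦-c⟧ := by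
          rw [hj]
          exact (nonempty_map_biprod_iso (emb A ⋙ shiftFunctor _ (1 : ℤ)) B₁ M).some
        refine ⟨B₀, B₁ ⊞ M, ⟨e ≪≫ biprod.mapIso f (Iso.refl _) ≪≫ ?_⟩⟩
        exact biprod.associator _ _ _ ≪≫ biprod.mapIso (Iso.refl _) a.symm

/-- An indecomposable object of the bounded derived category is a shift of an object of `A`. -/
lemma exists_iso_shift_of_indecomposable {Y : Db A} (hY : Indecomposable Y) :
    ∃ (M : A) (n : ℤ), Nonempty (Y ≅ ((emb A).obj M)⟦n⟧) := by
  obtain ⟨c, hc⟩ := exists_isSumOfShifts hher Y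
  clear hher
  induction hc with
  | zero c X hX => exact (hY.1 hX).elim
  | step c X X' M e hX ih =>
    obtain h | h := hY.2 _ _ e
    · obtain ⟨f⟩ := Indecomposable.iso_of_retract hY ((retractRight _ _).trans (.ofIso e.symm))
        (fun h' => hY.1 (IsZero.of_iso (isZero_of_noHom_self (noHom_biprod_left
          (fun f => h.eq_of_src f 0) fun f => h'.eq_of_src f 0)) e))
      exact ⟨M, -c, ⟨f.symm⟩⟩
    · have : IsIso (biprod.inl : X ⟶ X ⊞ ((emb A).obj M)⟦-c⟧) :=
        (Biprod.isIso_inl_iff_isZero _ _).2 h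
      have f : X' ≅ X := e ≪≫ (asIso biprod.inl).symm
      obtain ⟨N, n, ⟨g⟩⟩ := ih ⟨fun h => hY.1 (h.of_iso f), fun Z W g => hY.2 Z W (f ≪≫ g)⟩
      exact ⟨N, n, ⟨f ≪≫ g⟩⟩

end Structure

/-! ### The Krull-Schmidt property -/

section Algebra

open Polynomial

/-- A finite dimensional algebra over an algebraically closed field without nontrivial idempotents
has residue field `k`. Write the minimal polynomial of `f` as `(X - c)ᵐ q` with `q` prime to `X - c`;
a Bézout relation `a (X - c)ᵐ + b q = 1` makes `(b q)(f)` idempotent. -/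
lemma scalarAddNilpotent_of_idempotents {k : Type*} [Field k] [IsAlgClosed k] {R : Type*} [Ring R]
    [Algebra k R] [Nontrivial R] [Module.Finite k R]
    (h : ∀ e : R, e * e = e → e = 0 ∨ e = 1) : ScalarAddNilpotent k R := by
  intro f
  have hint : IsIntegral k f := IsIntegral.of_finite k f
  obtain ⟨c, hc⟩ := IsAlgClosed.exists_root (minpoly k f) (minpoly.degree_pos hint).ne'
  obtain ⟨q, hq, hdvd⟩ := exists_eq_pow_rootMultiplicity_mul_and_not_dvd (minpoly k f)
    (minpoly.ne_zero hint) c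
  set m := (minpoly k f).rootMultiplicity c
  have hcop : IsCoprime ((X - C c) ^ m) q :=
    IsCoprime.pow_left ((irreducible_X_sub_C c).coprime_iff_not_dvd.2 hdvd)
  obtain ⟨a, b, hab⟩ := hcop
  have h0 : aeval f ((X - C c) ^ m * q) = 0 := by rw [← hq, minpoly.aeval]
  have hmul : b * q * (b * q) = b * q - a * b * ((X - C c) ^ m * q) := by
    linear_combination b * q * hab
  have he := congrArg (aeval f) hmul
  rw [map_sub, map_mul (aeval f) (a * b), h0, mul_zero, sub_zero, map_mul] at he
  refine ⟨c, m, ?_⟩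
  have h1 := congrArg (aeval f) hab
  rw [map_add, map_one] at h1
  have hX : aeval f (X - C c) = f - algebraMap k R c := by simp
  obtain he | he := h _ he
  · -- then `q` annihilates `f`, so the minimal polynomial divides `q`
    exfalso
    rw [he, add_zero] at h1
    have : aeval f q = 0 := by
      rw [← one_mul (aeval f q), ← h1, ← map_mul, mul_assoc, map_mul, h0, mul_zero]
    exact hdvd ((dvd_iff_isRoot.2 hc).trans (minpoly.dvd k f this))
  · -- here `(b q)(f) = 1`, so that `(f - c)ᵐ` is a multiple of `((X - c)ᵐ q)(f) = 0`
    rw [← hX, ← map_pow, ← mul_one (aeval f _), ← he, ← map_mul,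
      show (X - C c) ^ m * (b * q) = b * ((X - C c) ^ m * q) by ring, map_mul, h0, mul_zero]

end Algebra

section Decomposition

variable {C : Type u} [Category.{v} C] [Preadditive C] [HasZeroObject C] [HasShift C ℤ]
  [∀ n : ℤ, (shiftFunctor C n).Additive] [Pretriangulated C] (k : Type t) [Field k] [Linear k C]

/-- The decomposition of a zero object. -/
def IndecDecomp.ofIsZero {X : C} (hX : IsZero X) : IndecDecomp X where
  n := 0
  F := Fin.elim0
  indec i := i.elim0
  iso := hX.iso ((IsZero.iff_id_eq_zero _).2 (biproduct.hom_ext _ _ fun i => i.elim0))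

/-- The decomposition of an indecomposable object. -/
def IndecDecomp.ofIndecomposable {X : C} (hX : Indecomposable X) : IndecDecomp X where
  n := 1
  F := fun _ => X
  indec _ := hX
  iso := (biproductUniqueIso fun _ : Fin 1 => X).symm

/-- The block diagonal endomorphisms of `Y ⊞ Z` form a subspace. -/
lemma finrank_biprod {Y Z : C} [Module.Finite k (Y ⊞ Z ⟶ Y ⊞ Z)] :
    Module.Finite k (Y ⟶ Y) ∧ Module.Finite k (Z ⟶ Z) ∧
      Module.finrank k (Y ⟶ Y) + Module.finrank k (Z ⟶ Z) ≤
        Module.finrank k (Y ⊞ Z ⟶ Y ⊞ Z) := by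
  let L : (Y ⟶ Y) × (Z ⟶ Z) →ₗ[k] (Y ⊞ Z ⟶ Y ⊞ Z) :=
    { toFun p := biprod.map p.1 p.2
      map_add' p q := by ext <;> simp
      map_smul' c p := by ext <;> simp }
  have hL : Function.Injective L := by
    rintro ⟨a, b⟩ ⟨a', b'⟩ h
    have h : biprod.map a b = biprod.map a' b' := h
    have h1 := congrArg (fun f => biprod.inl ≫ f ≫ biprod.fst) h
    have h2 := congrArg (fun f => biprod.inr ≫ f ≫ biprod.snd) h
    simp at h1 h2
    rw [h1, h2]
  have : Module.Finite k ((Y ⟶ Y) × (Z ⟶ Z)) := Module.Finite.of_injective L hL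
  have h1 : Module.Finite k (Y ⟶ Y) :=
    Module.Finite.of_surjective (LinearMap.fst k _ (Z ⟶ Z)) LinearMap.fst_surjective
  have h2 : Module.Finite k (Z ⟶ Z) :=
    Module.Finite.of_surjective (LinearMap.snd k (Y ⟶ Y) _) LinearMap.snd_surjective
  refine ⟨h1, h2, ?_⟩
  rw [← Module.finrank_prod]
  exact LinearMap.finrank_le_finrank_of_injective hL

/-- The linear isomorphism of endomorphism spaces given by conjugation. -/
def endLinearEquiv {X Y : C} (e : X ≅ Y) : (X ⟶ X) ≃ₗ[k] (Y ⟶ Y) where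
  toFun f := e.inv ≫ f ≫ e.hom
  invFun f := e.hom ≫ f ≫ e.inv
  map_add' f g := by simp
  map_smul' c f := by simp
  left_inv f := by simp
  right_inv f := by simp

/-- Induction on the dimension of the endomorphism algebra. -/
lemma nonempty_indecDecomp_of_finite (X : C) [Module.Finite k (X ⟶ X)] :
    Nonempty (IndecDecomp X) := by
  obtain ⟨n, hn⟩ : ∃ n, Module.finrank k (X ⟶ X) = n := ⟨_, rfl⟩
  induction n using Nat.strong_induction_on generalizing X with
  | _ n ih =>
    by_cases hX : IsZero X
    · exact ⟨.ofIsZero hX⟩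
    by_cases hX' : Indecomposable X
    · exact ⟨.ofIndecomposable hX'⟩
    obtain ⟨Y, Z, e, hY, hZ⟩ : ∃ (Y Z : C) (_ : X ≅ Y ⊞ Z), ¬ IsZero Y ∧ ¬ IsZero Z := by
      by_contra! h
      exact hX' ⟨hX, fun Y Z e => or_iff_not_imp_left.2 (h Y Z e)⟩
    have := Module.Finite.equiv (endLinearEquiv k e)
    have hn' := (endLinearEquiv k e).finrank_eq
    obtain ⟨h1, h2, hle⟩ := finrank_biprod k (Y := Y) (Z := Z)
    have pos : ∀ W : C, ¬ IsZero W → Module.Finite k (W ⟶ W) →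
        0 < Module.finrank k (W ⟶ W) := fun W hW _ => by
      have : Nontrivial (W ⟶ W) := ⟨⟨𝟙 W, 0, fun h => hW ((IsZero.iff_id_eq_zero W).2 h)⟩⟩
      exact Module.finrank_pos
    have p1 := pos Y hY h1
    have p2 := pos Z hZ h2
    obtain ⟨dY⟩ := ih _ (by lia) Y rfl
    obtain ⟨dZ⟩ := ih _ (by lia) Z rfl
    exact ⟨(dY.sum dZ).ofIso e⟩

end Decomposition

section

variable {A : Type u} [Category.{v} A] [Abelian A] [HasDerivedCategory.{w} A]
  (k : Type t) [Field k] [Linear k A]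

/-- Endomorphisms of `M` and of its shift in the derived category agree. -/
def endEmbShift (M : A) (n : ℤ) : (M ⟶ M) ≃ₗ[k] (((emb A).obj M)⟦n⟧ ⟶ ((emb A).obj M)⟦n⟧) :=
  LinearEquiv.ofBijective
    { toFun f := (emb A ⋙ shiftFunctor _ n).map f
      map_add' _ _ := Functor.map_add _
      map_smul' _ _ := Functor.map_smul _ _ _ }
    ⟨(emb A ⋙ shiftFunctor _ n).map_injective, (emb A ⋙ shiftFunctor _ n).map_surjective⟩

variable (hfin : ∀ X Y : A, Module.Finite k (X ⟶ Y)) (hher : Hereditary A)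
include hfin

omit hfin in
/-- Idempotent endomorphisms of a shift of an object of `A` split. -/
lemma exists_splitting {Y : Db A} {M : A} {n : ℤ} (f : Y ≅ ((emb A).obj M)⟦n⟧) (e : Y ⟶ Y)
    (he : e ≫ e = e) : ∃ (X : Db A) (r : Retract X Y), r.r ≫ r.i = e := by
  let F := emb A ⋙ shiftFunctor (Db A) n
  obtain ⟨e', he'⟩ := F.map_surjective (f.inv ≫ e ≫ f.hom)
  obtain ⟨X, i, p, hip, hpi⟩ := IsIdempotentComplete.idempotents_split M e'
    (F.map_injective (by rw [F.map_comp, he']; simp [reassoc_of% he]))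
  refine ⟨F.obj X, ⟨F.map i ≫ f.inv, f.hom ≫ F.map p, ?_⟩, ?_⟩
  · rw [Category.assoc]
    refine (congrArg (F.map i ≫ ·) (f.inv_hom_id_assoc (F.map p))).trans ?_
    rw [← F.map_comp, hip, F.map_id]
  · rw [Category.assoc, ← F.map_comp_assoc, hpi, he']
    simp

include hher

/-- The bounded derived category of a `Hom`-finite hereditary category is a Krull-Schmidt category.
An idempotent of an indecomposable object, which is a shift of an object of `A`, splits already in
`A`; so it is `0` or `1`. -/
lemma krullSchmidt_Db [IsAlgClosed k] : KrullSchmidt (Db A) k where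
  decomp X := by
    obtain ⟨c, hc⟩ := exists_isSumOfShifts hher X
    clear hher
    induction hc with
    | zero c X hX => exact ⟨.ofIsZero hX⟩
    | step c X X' M e hX ih =>
      have := hfin M M
      have := Module.Finite.equiv (endEmbShift k M (-c))
      exact ⟨(ih.some.sum (nonempty_indecDecomp_of_finite k _).some).ofIso e⟩
  local_end Y hY := by
    have hidem : ∀ e : Y ⟶ Y, e ≫ e = e → e = 0 ∨ e = 𝟙 Y := by
      intro e he
      obtain ⟨M, n, ⟨f⟩⟩ := exists_iso_shift_of_indecomposable hher hY
      obtain ⟨X, r, hr⟩ := exists_splitting f e he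
      by_cases hX : IsZero X
      · exact Or.inl (by rw [← hr, hX.eq_of_src r.i 0, comp_zero])
      · have := Indecomposable.isIso_of_retract hY r hX
        exact Or.inr (by rw [← hr, ← cancel_epi r.i, r.retract_assoc, Category.comp_id])
    have : Nontrivial (End Y) := ⟨⟨𝟙 Y, 0, fun h => hY.1 ((IsZero.iff_id_eq_zero Y).2 h)⟩⟩
    have : Module.Finite k (End Y) := by
      obtain ⟨M, n, ⟨e⟩⟩ := exists_iso_shift_of_indecomposable hher hY
      have := hfin M M
      have := Module.Finite.equiv (endEmbShift k M n)
      exact Module.Finite.equiv (endLinearEquiv k e.symm)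
    exact scalarAddNilpotent_of_idempotents hidem

end

/-! ### Rigid indecomposable objects are exceptional -/

section HappelRingel

variable {A : Type u} [Category.{v} A] [Abelian A] [HasDerivedCategory.{w} A]
  (k : Type t) [Field k] [Linear k A]

omit [HasDerivedCategory.{w} A] in
lemma not_mono_of_isNilpotent {M : A} (hM : ¬ IsZero M) {f : End M} (hf : IsNilpotent f) :
    ¬ Mono (f : M ⟶ M) := fun _ => by
  obtain ⟨n, hn⟩ := hf
  have : Mono ((f ^ n : End M) : M ⟶ M) := by
    clear hn
    induction n with
    | zero => exact inferInstanceAs (Mono (𝟙 M))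
    | succ n ih => exact mono_comp _ _
  exact hM ((IsZero.iff_id_eq_zero M).2 ((cancel_mono ((f ^ n : End M) : M ⟶ M)).1
    (by rw [hn]; exact (comp_zero).trans (comp_zero).symm)))

omit [HasDerivedCategory.{w} A] in
lemma not_epi_of_isNilpotent {M : A} (hM : ¬ IsZero M) {f : End M} (hf : IsNilpotent f) :
    ¬ Epi (f : M ⟶ M) := fun _ => by
  obtain ⟨n, hn⟩ := hf
  have : Epi ((f ^ n : End M) : M ⟶ M) := by
    clear hn
    induction n with
    | zero => exact inferInstanceAs (Epi (𝟙 M))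
    | succ n ih => exact epi_comp _ _
  exact hM ((IsZero.iff_id_eq_zero M).2 ((cancel_epi ((f ^ n : End M) : M ⟶ M)).1
    (by rw [hn]; exact (zero_comp).trans (zero_comp).symm)))

variable {k}

omit [HasDerivedCategory.{w} A] in
lemma idempotent_eq_zero_or_one {M : A} (h : ScalarAddNilpotent k (End M)) {e : M ⟶ M}
    (he : e ≫ e = e) : e = 0 ∨ e = 𝟙 M := by
  have he' : End.of e * End.of e = End.of e := he
  obtain ⟨n, hn⟩ | hu := h.isNilpotent_or_isUnit (End.of e)
  · left
    have : End.of e ^ (n + 1) = End.of e := IsIdempotentElem.pow_succ_eq n he'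
    rw [pow_succ, hn, zero_mul] at this
    exact this.symm
  · right
    exact hu.mul_left_cancel (he'.trans (mul_one (End.of e)).symm)

/-- The argument of Happel and Ringel: the extension of the cokernel of `f` by its image lifts
along `M ⟶ image f` as `Ext²` vanishes; the lift is a pushout of the extension itself as
`Ext¹(M, M)` vanishes. Hence either `M ⟶ image f` is mono, or the extension splits. -/
lemma mono_or_epi_of_rigid (hher : Hereditary A) {M : A} (h : ScalarAddNilpotent k (End M))
    (hM : HomVanish ((emb A).obj M) ((emb A).obj M) 1) {f : M ⟶ M} (hf : f ≠ 0) :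
    Mono f ∨ Epi f := by
  let I := Abelian.image f
  let i : I ⟶ M := Abelian.image.ι f
  let p : M ⟶ I := Abelian.factorThruImage f
  have hpi : p ≫ i = f := Abelian.image.fac f
  let S₁ : ShortComplex A := ShortComplex.mk (kernel.ι p) p (kernel.condition p)
  have hS₁ : S₁.ShortExact :=
    { exact := ShortComplex.exact_kernel p
      mono_f := inferInstanceAs (Mono (kernel.ι p))
      epi_g := inferInstanceAs (Epi p) }
  let S₂ : ShortComplex A := ShortComplex.mk i (cokernel.π i) (cokernel.condition i)
  have hS₂ : S₂.ShortExact :=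
    { exact := ShortComplex.exact_cokernel i
      mono_f := inferInstanceAs (Mono i)
      epi_g := inferInstanceAs (Epi (cokernel.π i)) }
  obtain ⟨ε, hT₁⟩ := exists_triangle_of_shortExact hS₁
  obtain ⟨δ, hT₂⟩ := exists_triangle_of_shortExact hS₂
  let G : A ⥤ Db A := emb A ⋙ shiftFunctor (Db A) (1 : ℤ)
  change (emb A).obj (cokernel i) ⟶ G.obj I at δ
  -- `Ext²(cokernel f, kernel f) = 0`
  obtain ⟨δ', hδ'⟩ : ∃ δ' : (emb A).obj (cokernel i) ⟶ G.obj M, δ = δ' ≫ G.map p := by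
    obtain ⟨δ', h⟩ := Triangle.coyoneda_exact₃ _
      (rot_of_distTriang _ (rot_of_distTriang _ (rot_of_distTriang _ hT₁))) δ
      ((homVanish_shift_right_iff (1 : ℤ) 1 2 (by lia)).2 (hher _ _ 2 le_rfl) _)
    change _ ⟶ G.obj M at δ'
    exact ⟨-δ', (h.trans (Preadditive.comp_neg _ _)).trans (Preadditive.neg_comp _ _).symm⟩
  -- `Ext¹(M, M) = 0`
  obtain ⟨r, hr⟩ : ∃ r : I ⟶ M, δ' = δ ≫ G.map r := by
    obtain ⟨g, hg⟩ := Triangle.yoneda_exact₃ _ hT₂ δ' (hM _)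
    obtain ⟨r, hr⟩ := G.map_surjective (X := I) (Y := M) g
    exact ⟨r, by rw [hr]; exact hg⟩
  have hx : δ' ≫ G.map (p ≫ r) = δ' := by
    rw [G.map_comp, ← Category.assoc, ← hδ', ← hr]
  obtain ⟨n, hn⟩ | hu := h.isNilpotent_or_isUnit (End.of (p ≫ r))
  · -- `δ'` is fixed by a nilpotent endomorphism, hence zero, and the extension splits
    right
    have key : ∀ m : ℕ, δ' ≫ G.map (End.of (p ≫ r) ^ m).asHom = δ' := by
      intro m
      induction m with
      | zero =>
        rw [pow_zero]
        exact (congrArg (δ' ≫ ·) (G.map_id M)).trans (Category.comp_id _)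
      | succ m ih =>
        rw [pow_succ']
        refine (congrArg (δ' ≫ ·) (G.map_comp _ _)).trans ?_
        rw [← Category.assoc]
        exact (congrArg (· ≫ _) ih).trans hx
    have hδ0 : δ' = 0 := by
      rw [← key n, hn]
      exact (congrArg (δ' ≫ ·) (G.map_zero _ _)).trans comp_zero
    have hδ : δ = 0 := by rw [hδ', hδ0, zero_comp]
    obtain ⟨e, he, -⟩ := exists_iso_binaryBiproduct_of_distTriang _ hT₂ hδ
    obtain ⟨ρ, hρ⟩ := (emb A).map_surjective (X := M) (Y := I) (e.hom ≫ biprod.fst)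
    have hiρ : i ≫ ρ = 𝟙 I := (emb A).map_injective (by
      rw [Functor.map_comp, hρ]
      refine (Category.assoc _ _ _).symm.trans ?_
      exact (congrArg (· ≫ biprod.fst) he).trans (biprod.inl_fst.trans ((emb A).map_id I).symm))
    obtain h0 | h1 := idempotent_eq_zero_or_one h (e := ρ ≫ i)
      (by rw [Category.assoc, reassoc_of% hiρ])
    · refine (hf ?_).elim
      rw [← hpi, ← Category.id_comp i, ← hiρ, Category.assoc, h0, comp_zero, comp_zero]
    · have : Epi i := ⟨fun a b hab => by
        rw [← Category.id_comp a, ← h1, Category.assoc, hab, ← Category.assoc, h1,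
          Category.id_comp]⟩
      rw [← hpi]
      exact epi_comp _ _
  · left
    have hu' : IsIso (p ≫ r) := (isUnit_iff_isIso _).1 hu
    have : Mono p := mono_of_mono p r
    rw [← hpi]
    exact mono_comp _ _

variable (k)

lemma scalarAddNilpotent_of_emb {M : A} (h : ScalarAddNilpotent k (End ((emb A).obj M))) :
    ScalarAddNilpotent k (End M) := by
  intro f
  obtain ⟨c, n, hn⟩ := h (End.of ((emb A).map f))
  refine ⟨c, n, (emb A).map_injective ?_⟩
  have h1 : (emb A).mapEnd M (f - algebraMap k (End M) c) =
      End.of ((emb A).map f) - algebraMap k (End ((emb A).obj M)) c := by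
    change (emb A).map (f.asHom - c • 𝟙 M) = (emb A).map f.asHom - c • 𝟙 _
    rw [Functor.map_sub, Functor.map_smul, CategoryTheory.Functor.map_id]
  have h2 := map_pow ((emb A).mapEnd M) (f - algebraMap k (End M) c) n
  rw [h1] at h2
  exact (h2.trans hn).trans ((emb A).map_zero _ _).symm

/-- A rigid indecomposable object of a hereditary category is exceptional: the nilpotent part of an
endomorphism would be mono or epi if it were nonzero. -/
lemma exceptionalIn_of_rigid (hher : Hereditary A) (hKS : KrullSchmidt (Db A) k) {M : A}
    (hM : Indecomposable ((emb A).obj M)) (h : HomVanish ((emb A).obj M) ((emb A).obj M) 1) :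
    ExceptionalIn k M := by
  have hM0 : ¬ IsZero M := fun h => hM.1 (isZero_emb_iff.2 h)
  have hl := scalarAddNilpotent_of_emb k (hKS.local_end _ hM)
  refine ⟨(finrank_eq_one_iff' (V := (emb A).obj M ⟶ (emb A).obj M) ).2
    ⟨𝟙 _, fun h => hM.1 ((IsZero.iff_id_eq_zero _).2 h), fun g => ?_⟩, fun i hi => ?_⟩
  · obtain ⟨f, rfl⟩ := (emb A).map_surjective g
    obtain ⟨c, hc⟩ := hl f
    refine ⟨c, ?_⟩
    have : f - c • 𝟙 M = 0 := by
      by_contra h0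
      obtain h1 | h1 := mono_or_epi_of_rigid hher hl h h0
      · exact not_mono_of_isNilpotent hM0 hc h1
      · exact not_epi_of_isNilpotent hM0 hc h1
    rw [sub_eq_zero.1 this, Functor.map_smul, CategoryTheory.Functor.map_id]
  · obtain hi | rfl | hi : i < 0 ∨ i = 1 ∨ 2 ≤ i := by lia
    · exact homVanish_emb_of_neg M M hi
    · exact h
    · exact hher _ _ i hi

end HappelRingel

/-! ### Exceptional objects -/

section Exceptional

variable {C : Type u} [Category.{v} C] [Preadditive C] [HasZeroObject C] [HasShift C ℤ]
  [∀ n : ℤ, (shiftFunctor C n).Additive] [Pretriangulated C] {k : Type t} [Field k] [Linear k C]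

lemma Exceptional.of_iso {X Y : C} (h : Exceptional k X) (e : X ≅ Y) : Exceptional k Y :=
  ⟨(endLinearEquiv k e).finrank_eq.symm.trans h.1,
    fun i hi => HomVanish.of_iso e.symm e.symm (h.2 i hi)⟩

lemma Exceptional.shift [∀ n : ℤ, (shiftFunctor C n).Linear k] {X : C} (h : Exceptional k X)
    (n : ℤ) : Exceptional k (X⟦n⟧) :=
  ⟨(LinearEquiv.ofBijective
      { toFun f := (shiftFunctor C n).map f
        map_add' _ _ := Functor.map_add _
        map_smul' _ _ := Functor.map_smul _ _ _ : (X ⟶ X) →ₗ[k] (X⟦n⟧ ⟶ X⟦n⟧) }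
      ⟨(shiftFunctor C n).map_injective, (shiftFunctor C n).map_surjective⟩).finrank_eq.symm.trans
      h.1,
    fun i hi => (homVanish_shift_iff n n i i (by lia)).2 (h.2 i hi)⟩

omit [HasZeroObject C] [∀ n : ℤ, (shiftFunctor C n).Additive] [Pretriangulated C] in
lemma Exceptional.exists_smul_id {X : C} (h : Exceptional k X) (f : X ⟶ X) :
    ∃ c : k, f = c • 𝟙 X := by
  have hX : 𝟙 X ≠ 0 := fun h0 => by
    have : Subsingleton (X ⟶ X) := ⟨fun a b => by
      rw [← Category.id_comp a, ← Category.id_comp b, h0, zero_comp, zero_comp]⟩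
    have h1 := h.1
    rw [Module.finrank_zero_of_subsingleton] at h1
    exact zero_ne_one h1
  obtain ⟨c, hc⟩ := (finrank_eq_one_iff_of_nonzero' (𝟙 X) hX).1 h.1 f
  exact ⟨c, hc.symm⟩

omit [HasZeroObject C] [∀ n : ℤ, (shiftFunctor C n).Additive] [Pretriangulated C] in
lemma Exceptional.not_isZero {X : C} (h : Exceptional k X) : ¬ IsZero X := fun h0 => by
  have : Subsingleton (X ⟶ X) := ⟨fun a b => h0.eq_of_src a b⟩
  have h1 := h.1
  rw [Module.finrank_zero_of_subsingleton] at h1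
  exact zero_ne_one h1

end Exceptional

/-! ### Summands of the outer terms of a triangle on an exceptional object -/

section Summands

variable {C : Type u} [Category.{v} C] [Preadditive C] [HasZeroObject C] [HasShift C ℤ]
  [∀ n : ℤ, (shiftFunctor C n).Additive] [Pretriangulated C] {k : Type t} [Field k] [Linear k C]

/-- Components of the first term of a triangle `U ⟶ E ⟶ V` with `E` exceptional and `v ≠ 0`.
If `Hom¹(V, Γ) = 0` for a summand `Γ` of `U`, then the projection `U ⟶ Γ` factors through the
exceptional object `E`, whose endomorphisms are scalars, and `u` is a split epimorphism. -/
lemma not_homVanish_obj₃_of_retract_obj₁ {T : Triangle C} (hT : T ∈ distTriang C)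
    (hE : Exceptional k T.obj₂) (hv : T.mor₂ ≠ 0) {Γ : C} (r : Retract Γ T.obj₁)
    (hΓ : ¬ IsZero Γ) : ¬ HomVanish T.obj₃ Γ 1 := by
  intro h
  obtain ⟨g, hg⟩ : ∃ g : T.obj₂ ⟶ Γ, r.r = T.mor₁ ≫ g :=
    Triangle.yoneda_exact₂ _ (inv_rot_of_distTriang _ hT) r.r
      (homVanish_zero_iff.1 ((homVanish_shift_left_iff (-1) 0 1 (by lia)).2 h) _)
  have h1 : r.i ≫ T.mor₁ ≫ g = 𝟙 Γ := by rw [← hg, r.retract]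
  obtain ⟨c, hc⟩ := hE.exists_smul_id (g ≫ r.i ≫ T.mor₁)
  have hc0 : c ≠ 0 := by
    rintro rfl
    rw [zero_smul] at hc
    refine hΓ ((IsZero.iff_id_eq_zero Γ).2 ?_)
    rw [← h1, ← Category.comp_id g, ← h1, reassoc_of% hc]
    simp
  apply hv
  have h2 : c • T.mor₂ = 0 := by
    rw [← Category.id_comp T.mor₂, ← Linear.smul_comp, ← hc]
    simp [comp_distTriang_mor_zero₁₂ _ hT]
  exact (smul_eq_zero.1 h2).resolve_left hc0

omit [Linear k C]

/-- If `Hom(Γ, E) = 0`, then the inclusion `Γ ⟶ U` factors through `V[-1]`. -/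
lemma not_homVanish_obj₂_of_retract_obj₁ {T : Triangle C} (hT : T ∈ distTriang C)
    (h : HomVanish T.obj₁ T.obj₃ (-1)) {Γ : C} (r : Retract Γ T.obj₁) (hΓ : ¬ IsZero Γ) :
    ¬ HomVanish Γ T.obj₂ 0 := fun h0 =>
  hΓ (isZero_of_noHom_self (NoHom.of_retract (.refl Γ) r (homVanish_zero_iff.1
    (homVanish_to₁ hT (-1) 0 (by lia) (HomVanish.of_retract r (.refl _) h) h0))))

/-- If `Hom(E, Γ) = 0`, then the projection `V ⟶ Γ` factors through `U[1]`. -/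
lemma not_homVanish_obj₂_of_retract_obj₃ {T : Triangle C} (hT : T ∈ distTriang C)
    (h : HomVanish T.obj₁ T.obj₃ (-1)) {Γ : C} (r : Retract Γ T.obj₃) (hΓ : ¬ IsZero Γ) :
    ¬ HomVanish T.obj₂ Γ 0 := fun h0 =>
  hΓ (isZero_of_noHom_self (NoHom.of_retract r (.refl Γ) (homVanish_zero_iff.1
    (homVanish_from₃ hT (-1) 0 (by lia) (HomVanish.of_retract (.refl _) r h) h0))))

lemma Indecomposable.of_iso {X Y : C} (h : Indecomposable X) (e : X ≅ Y) : Indecomposable Y :=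
  ⟨fun h' => h.1 (h'.of_iso e), fun _ _ f => h.2 _ _ (e ≪≫ f)⟩

lemma IndecDecomp.exists_not_homVanish_right {W X : C} (d : IndecDecomp X) {i : ℤ}
    (h : ¬ HomVanish W X i) : ∃ j, ¬ HomVanish W (d.F j) i := by
  by_contra! h'
  refine h fun f => ?_
  rw [← Category.comp_id f, ← CategoryTheory.Functor.map_id, ← d.sum_retract, Functor.map_sum,
    Preadditive.comp_sum]
  refine Finset.sum_eq_zero fun j _ => ?_
  rw [Functor.map_comp, ← Category.assoc, h' j (f ≫ _), zero_comp]

lemma IndecDecomp.exists_not_homVanish_left {W X : C} (d : IndecDecomp X) {i : ℤ}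
    (h : ¬ HomVanish X W i) : ∃ j, ¬ HomVanish (d.F j) W i := by
  by_contra! h'
  refine h fun f => ?_
  rw [← Category.id_comp f, ← d.sum_retract, Preadditive.sum_comp]
  refine Finset.sum_eq_zero fun j _ => ?_
  rw [Category.assoc, h' j (_ ≫ f), comp_zero]

end Summands

/-! ### Fibres of morphisms of a hereditary category -/

section Fibre

variable {A : Type u} [Category.{v} A] [Abelian A] [HasDerivedCategory.{w} A]

/-- In the derived category of a hereditary category, the fibre of a morphism `f` is the sum of
its kernel and of its cokernel shifted by `-1`. -/
lemma exists_fibre (hher : Hereditary A) {E B : A} (f : E ⟶ B) :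
    ∃ (A₁ A₂ : A) (m : A₁ ⟶ E) (U : Db A) (a : U ⟶ (emb A).obj E)
      (b : (emb A).obj B ⟶ U⟦(1 : ℤ)⟧), Mono m ∧ m ≫ f = 0 ∧
      Triangle.mk a ((emb A).map f) b ∈ distTriang (Db A) ∧
      Nonempty (U ≅ (emb A).obj A₁ ⊞ ((emb A).obj A₂)⟦(-1 : ℤ)⟧) := by
  let I := Abelian.image f
  let i : I ⟶ B := Abelian.image.ι f
  let p : E ⟶ I := Abelian.factorThruImage f
  have hpi : p ≫ i = f := Abelian.image.fac f
  let S₁ : ShortComplex A := ShortComplex.mk (kernel.ι p) p (kernel.condition p)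
  have hS₁ : S₁.ShortExact :=
    { exact := ShortComplex.exact_kernel p
      mono_f := inferInstanceAs (Mono (kernel.ι p))
      epi_g := inferInstanceAs (Epi p) }
  let S₂ : ShortComplex A := ShortComplex.mk i (cokernel.π i) (cokernel.condition i)
  have hS₂ : S₂.ShortExact :=
    { exact := ShortComplex.exact_cokernel i
      mono_f := inferInstanceAs (Mono i)
      epi_g := inferInstanceAs (Epi (cokernel.π i)) }
  obtain ⟨ε, hT₁⟩ := exists_triangle_of_shortExact hS₁
  obtain ⟨δ, hT₂⟩ := exists_triangle_of_shortExact hS₂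
  obtain ⟨U, a, b, hU⟩ := distinguished_cocone_triangle₁ ((emb A).map f)
  have comm : (emb A).map p ≫ (emb A).map i = (emb A).map f := by
    rw [← Functor.map_comp, hpi]
  let O := Triangulated.someOctahedron' comm hT₁ (inv_rot_of_distTriang _ hT₂) hU
  have h0 : O.triangle.mor₃ = 0 :=
    (homVanish_shift_left_iff (-1) 1 2 (by lia)).2 (hher _ _ 2 le_rfl) _
  obtain ⟨e, -⟩ := exists_iso_binaryBiproduct_of_distTriang _ O.mem h0
  exact ⟨kernel p, cokernel i, kernel.ι p, U, a, b, inferInstance,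
    by rw [← hpi, kernel.condition_assoc, zero_comp], hU, ⟨e⟩⟩

end Fibre

/-! ### The dichotomy for non-semistable exceptional objects -/

section Dichotomy

open StabilityCondition

variable {A : Type u} [Category.{v} A] [Abelian A] [HasDerivedCategory.{w} A]
  {k : Type t} [Field k] [Linear k A]

/-- The factor of minimal phase of an exceptional object of `A` lies in `A ⊕ A[1]`, as all its
summands receive nonzero morphisms from the object. -/
lemma exists_sigmaMinus_iso (hher : Hereditary A) (σ : StabilityCondition (Db A)) {F : A}
    (hF : ¬ IsZero ((emb A).obj F)) :
    ∃ B₀ B₁ : A, Nonempty (σ.sigmaMinus _ hF ≅ (emb A).obj B₀ ⊞ ((emb A).obj B₁)⟦(1 : ℤ)⟧) := by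
  refine exists_iso_biprod_shift hher _ fun M j ⟨r⟩ hM => ?_
  by_contra! hj
  have hneg := Gt.homVanish_of_nonpos (hnMinus_gt _ hF) (sigmaMinus_mem (σ := σ) _ hF) (i := -1) (by lia)
  refine not_homVanish_obj₂_of_retract_obj₃ (σ.hnMinus_distinguished _ hF) hneg r
    (fun h => hM (isZero_emb_iff.1 ((isZero_shift_iff j).1 h))) ?_
  refine (homVanish_shift_right_iff j 0 j (by lia)).2 ?_
  obtain h | h : j < 0 ∨ 2 ≤ j := by lia
  · exact homVanish_emb_of_neg F M h
  · exact hher F M j h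

variable (k) in
/-- An obstruction to the regularity of `F`: an object `Γ` forming an Ext-nontrivial couple with
`F`, such that `Homⁱ(Γ, G) = 0` whenever `Hom^*(F, G) = 0` and `G[i]` is semistable of phase at most
`s`. -/
def Obstruction (σ : StabilityCondition (Db A)) (F : A) (s : ℝ) (Γ : A) : Prop :=
  ExtNontrivialCouple k F Γ ∧ ∀ (G : A) (i : ℤ) (r : ℝ),
    HomVanishAll ((emb A).obj F) ((emb A).obj G) → r ≤ s → σ.P r (((emb A).obj G)⟦i⟧) →
    HomVanish ((emb A).obj Γ) ((emb A).obj G) i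

variable (hher : Hereditary A) (hKS : KrullSchmidt (Db A) k)

include hKS in
/-- A nonzero morphism to a shift of an object of `A` has a nonzero component at an indecomposable
summand. -/
lemma exists_summand_right {W : Db A} {X : A} {i : ℤ} (h : ¬ HomVanish W ((emb A).obj X) i) :
    ∃ Γ : A, Nonempty (Retract ((emb A).obj Γ) ((emb A).obj X)) ∧
      Indecomposable ((emb A).obj Γ) ∧ ¬ HomVanish W ((emb A).obj Γ) i := by
  obtain ⟨d⟩ := hKS.decomp ((emb A).obj X)
  obtain ⟨j, hj⟩ := d.exists_not_homVanish_right h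
  obtain ⟨Γ, -, ⟨e⟩⟩ := exists_iso_of_retract_emb (d.retract j)
  exact ⟨Γ, ⟨(Retract.ofIso e.symm).trans (d.retract j)⟩, Indecomposable.of_iso (d.indec j) e,
    fun h' => hj (HomVanish.of_iso (Iso.refl _) e h')⟩

include hKS in
lemma exists_summand_left {W : Db A} {X : A} {i : ℤ} (h : ¬ HomVanish ((emb A).obj X) W i) :
    ∃ Γ : A, Nonempty (Retract ((emb A).obj Γ) ((emb A).obj X)) ∧
      Indecomposable ((emb A).obj Γ) ∧ ¬ HomVanish ((emb A).obj Γ) W i := by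
  obtain ⟨d⟩ := hKS.decomp ((emb A).obj X)
  obtain ⟨j, hj⟩ := d.exists_not_homVanish_left h
  obtain ⟨Γ, -, ⟨e⟩⟩ := exists_iso_of_retract_emb (d.retract j)
  exact ⟨Γ, ⟨(Retract.ofIso e.symm).trans (d.retract j)⟩, Indecomposable.of_iso (d.indec j) e,
    fun h' => hj (HomVanish.of_iso e (Iso.refl _) h')⟩

include hKS in
/-- Multiplicities increase strictly at an indecomposable summand of `V`. -/
lemma theta_lt_of_eq_add {σ : StabilityCondition (Db A)} {s : ℝ} {U X V : Db A} (hV : ¬ IsZero V)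
    (hVs : σ.P s V) (h : ∀ Y, σ.theta X Y = σ.theta U Y + multiplicity V Y.1) :
    σ.theta U < σ.theta X := by
  obtain ⟨Y, hY, ⟨r⟩, hpos⟩ := hKS.exists_multiplicity_pos hV
  refine Pi.lt_def.2 ⟨fun Y => (h Y).symm ▸ Nat.le_add_right _ _,
    ⟨Y, ⟨hY.1, s, mem_of_retract hVs r⟩, hY⟩, ?_⟩
  rw [h]
  exact Nat.lt_add_of_pos_right hpos

include hher hKS

/-- The case where `σ₋(F)` lies in `A[1]`. The triangle `HN₋(F)` is `X ⟶ F ⟶ B₁[1]`, and it is of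
type C3 if `Ext¹(B₁, F) = 0`; otherwise a summand of `B₁` is an obstruction. -/
lemma isC3_or_obstruction {σ : StabilityCondition (Db A)} {F : A}
    (hF : ¬ IsZero ((emb A).obj F)) (hexc : ExceptionalIn k F)
    (hss : ¬ σ.Semistable ((emb A).obj F)) {B₀ B₁ : A}
    (split : σ.sigmaMinus _ hF ≅ (emb A).obj B₀ ⊞ ((emb A).obj B₁)⟦(1 : ℤ)⟧) (hB₀ : IsZero B₀) :
    (∃ T : AlgTriangle σ F hF, T.IsC3) ∨
      ∃ Γ, Obstruction k σ F (σ.phiMinus ((emb A).obj F)) Γ := by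
  set s := σ.phiMinus ((emb A).obj F) with hs
  set V := σ.sigmaMinus _ hF with hVdef
  have hT := σ.hnMinus_distinguished _ hF
  set U := (σ.hnMinus _ hF).obj₁ with hUdef
  have hU : σ.Gt s U := hnMinus_gt _ hF
  have hVs : σ.P s V := sigmaMinus_mem _ hF
  have hV0 : ¬ IsZero V := sigmaMinus_not_isZero _ hF
  have : IsIso (biprod.inl : ((emb A).obj B₁)⟦(1 : ℤ)⟧ ⟶ _ ⊞ (emb A).obj B₀) :=
    (Biprod.isIso_inl_iff_isZero _ _).2 (isZero_emb_iff.2 hB₀)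
  have eV : V ≅ ((emb A).obj B₁)⟦(1 : ℤ)⟧ := split ≪≫ biprod.braiding _ _ ≪≫ (asIso biprod.inl).symm
  have eV' : V⟦(-1 : ℤ)⟧ ≅ (emb A).obj B₁ :=
    (shiftFunctor _ (-1 : ℤ)).mapIso eV ≪≫
      (shiftFunctorCompIsoId (Db A) (1 : ℤ) (-1) (by simp)).app _
  obtain ⟨X, ⟨eU⟩⟩ := exists_iso_emb_of_triangle (inv_rot_of_distTriang _ hT) eV' (Iso.refl _)
  change U ≅ (emb A).obj X at eU
  have hB₁0 : ¬ IsZero B₁ := fun h =>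
    hV0 (((isZero_shift_iff 1).2 (isZero_emb_iff.2 h)).of_iso eV)
  have hUV : HomVanishAll U V := fun i => by
    obtain hi | hi : i ≤ 0 ∨ 1 ≤ i := by lia
    · exact Gt.homVanish_of_nonpos hU hVs hi
    · exact HomVanish.of_iso eU eV ((homVanish_shift_right_iff 1 i (i + 1) (by lia)).2
        (hher _ _ _ (by lia)))
  have hVV1 : HomVanish V V 1 := by
    refine homVanish_from₃ hT 0 1 (by lia) (hUV 0) ?_
    exact HomVanish.of_iso (Iso.refl _) eV ((homVanish_shift_right_iff 1 1 2 (by lia)).2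
      (hher _ _ 2 le_rfl))
  have hBB1 : HomVanish ((emb A).obj B₁) ((emb A).obj B₁) 1 :=
    (homVanish_shift_iff 1 1 1 1 (by lia)).1 (HomVanish.of_iso eV.symm eV.symm hVV1)
  have hFF1 : HomVanish ((emb A).obj F) ((emb A).obj F) 1 := hexc.2 1 one_ne_zero
  have toV : ∀ Γ : Db A, Retract Γ ((emb A).obj B₁) → Retract (Γ⟦(1 : ℤ)⟧) V := fun Γ r =>
    (r.map (shiftFunctor _ (1 : ℤ))).trans (.ofIso eV.symm)
  have hFΓ : ∀ Γ : Db A, Retract Γ ((emb A).obj B₁) → ¬ IsZero Γ →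
      ¬ HomVanish ((emb A).obj F) Γ 1 := fun Γ r hΓ h =>
    not_homVanish_obj₂_of_retract_obj₃ hT (hUV (-1)) (toV Γ r)
      (fun h => hΓ ((isZero_shift_iff 1).1 h))
      ((homVanish_shift_right_iff 1 0 1 (by lia)).2 h)
  by_cases hBF : HomVanish ((emb A).obj B₁) ((emb A).obj F) 1
  · left
    have hUF1 : HomVanish U ((emb A).obj F) 1 := by
      refine homVanish_from₁ hT 1 2 (by lia) hFF1 ?_
      exact HomVanish.of_iso eV (Iso.refl _) ((homVanish_shift_left_iff 1 2 1 (by lia)).2 hBF)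
    have hUU1 : HomVanish U U 1 := homVanish_to₁ hT 0 1 (by lia) (hUV 0) hUF1
    have hU0 : ¬ IsZero U := fun h => by
      have := (Triangle.isZero₁_iff_isIso₂ _ hT).1 h
      exact hss (semistable_of_iso (asIso (σ.hnMinus _ hF).mor₂).symm ⟨hV0, s, hVs⟩)
    have hθ : σ.theta U < σ.theta ((emb A).obj F) :=
      theta_lt_of_eq_add hKS hV0 hVs (theta_eq_add hKS hT hU hVs)
    have hφ : s < σ.phiMinus U := lt_phiMinus hU0 hU
    have hv : (σ.hnMinus _ hF).mor₂ ≠ 0 := mor₂_ne_zero_of_homVanish hT (hUV (-1)) hV0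
    let T : AlgTriangle σ F hF :=
      { B₀ := B₀
        B₁ := B₁
        split := split
        U := U
        V := V
        u := (σ.hnMinus _ hF).mor₁
        v := (σ.hnMinus _ hF).mor₂
        w := (σ.hnMinus _ hF).mor₃
        dist := hT
        of_ne_zero h := (h hB₀).elim
        of_zero _ := ⟨Iso.refl _, Category.comp_id _⟩ }
    refine ⟨T, ⟨hU0, ⟨hV0, s, hVs⟩, Or.inr ⟨eV⟩, hθ, hVs, hφ.le, fun Γ hΓ => ?_, hUV, hUU1, hVV1⟩,
      X, B₁, ⟨eU⟩, ⟨eV⟩, fun h => hU0 ((isZero_emb_iff.2 h).of_iso eU), hB₁0,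
      HomVanish.of_iso eU.symm eU.symm hUU1, hBB1, fun i => ?_, ⟨Iso.refl _⟩, ?_, ?_, ?_,
      fun Γ hΓ => ?_, fun Γ hΓ => ?_⟩
    · obtain ⟨⟨r⟩, hΓ⟩ := hΓ.exists_retract
      exact not_homVanish_obj₂_of_retract_obj₃ hT (hUV (-1)) r hΓ.1
    · exact (homVanish_shift_right_iff 1 (i - 1) i (by lia)).1
        (HomVanish.of_iso eU.symm eV.symm (hUV (i - 1)))
    · rwa [← theta_iso hKS eU]
    · exact lt_phiMinus (fun h => hU0 (h.of_iso eU))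
        (hU.of_retract (.ofIso eU.symm))
    · exact mem_of_shift 1 (mem_of_iso eV hVs) (by push_cast; ring)
    · obtain ⟨⟨r⟩, hΓ⟩ := hΓ.exists_retract
      exact ⟨hFΓ Γ r hΓ.1, HomVanish.of_retract r (.refl _) hBF⟩
    · obtain ⟨⟨r⟩, hΓ⟩ := hΓ.exists_retract
      have r' : Retract Γ U := r.trans (.ofIso eU.symm)
      refine ⟨fun h => ?_, not_homVanish_obj₂_of_retract_obj₁ hT (hUV (-1)) r' hΓ.1⟩
      refine not_homVanish_obj₃_of_retract_obj₁ hT hexc hv r' hΓ.1 ?_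
      exact HomVanish.of_iso eV (Iso.refl _) ((homVanish_shift_left_iff 1 1 0 (by lia)).2 h)
  · right
    obtain ⟨Γ, ⟨r⟩, hΓ, hΓF⟩ := exists_summand_left hKS hBF
    have hΓΓ := HomVanish.of_retract r r hBB1
    refine ⟨Γ, ⟨hexc, exceptionalIn_of_rigid k hher hKS hΓ hΓΓ, hFΓ _ r hΓ.1, hΓF⟩, ?_⟩
    intro G i p hFG hp hG
    refine HomVanish.of_retract r (.refl _) ?_
    -- `Homⁱ(B₁, G) = Homⁱ⁺¹(V, G)` lies between `Homⁱ(U, G)` and `Homⁱ⁺¹(F, G)`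
    have h1 : HomVanish U ((emb A).obj G) i := hU p hp _ hG
    have h2 : HomVanish V ((emb A).obj G) (i + 1) := homVanish_from₃ hT i (i + 1) rfl h1 (hFG _)
    exact (homVanish_shift_left_iff 1 (i + 1) i rfl).1
      (HomVanish.of_iso eV.symm (Iso.refl _) h2)

end Dichotomy

section Dichotomy

open StabilityCondition

variable {A : Type u} [Category.{v} A] [Abelian A] [HasDerivedCategory.{w} A]
  {k : Type t} [Field k] [Linear k A] (hher : Hereditary A) (hKS : KrullSchmidt (Db A) k)

include hher hKS

/-- The case where `σ₋(F)` has a nonzero summand `B₀` in `A`. The fibre of `F ⟶ B₀` is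
`A₁ ⊕ A₂[-1]`, and the triangle is of type C1 or C2 if `Ext¹(F, A₂) = 0`; otherwise a summand of
`A₂` is an obstruction. -/
lemma isC1_or_isC2_or_obstruction {σ : StabilityCondition (Db A)} {F : A}
    (hF : ¬ IsZero ((emb A).obj F)) (hexc : ExceptionalIn k F)
    (hss : ¬ σ.Semistable ((emb A).obj F)) {B₀ B₁ : A}
    (split : σ.sigmaMinus _ hF ≅ (emb A).obj B₀ ⊞ ((emb A).obj B₁)⟦(1 : ℤ)⟧)
    (hB₀ : ¬ IsZero B₀) :
    (∃ T : AlgTriangle σ F hF, T.IsC1 ∨ T.IsC2) ∨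
      ∃ Γ, Obstruction k σ F (σ.phiMinus ((emb A).obj F)) Γ := by
  set s := σ.phiMinus ((emb A).obj F) with hs
  have hN := σ.hnMinus_distinguished _ hF
  have hU₀ : σ.Gt s (σ.hnMinus _ hF).obj₁ := hnMinus_gt _ hF
  have hVs : σ.P s (σ.sigmaMinus _ hF) := sigmaMinus_mem _ hF
  have hFF1 : HomVanish ((emb A).obj F) ((emb A).obj F) 1 := hexc.2 1 one_ne_zero
  have hB₀s : σ.P s ((emb A).obj B₀) :=
    mem_of_retract hVs ((retractLeft _ _).trans (.ofIso split.symm))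
  have hB₁s : σ.P s (((emb A).obj B₁)⟦(1 : ℤ)⟧) :=
    mem_of_retract hVs ((retractRight _ _).trans (.ofIso split.symm))
  have hB₀0 : ¬ IsZero ((emb A).obj B₀) := fun h => hB₀ (isZero_emb_iff.1 h)
  obtain ⟨f, hf⟩ := (emb A).map_surjective (σ.toSigmaMinus _ hF ≫ split.hom ≫ biprod.fst)
  obtain ⟨A₁, A₂, m, U, a, b, hm, hmf, hT, ⟨eU⟩⟩ := exists_fibre hher f
  -- the octahedron of `F ⟶ σ₋(F) ⟶ B₀` compares `U` with the first term of `HN₋(F)`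
  obtain ⟨j, hS⟩ : ∃ j : ((emb A).obj B₁)⟦(1 : ℤ)⟧ ⟶ σ.sigmaMinus _ hF,
      Triangle.mk j (split.hom ≫ biprod.fst) 0 ∈ distTriang (Db A) := by
    refine ⟨biprod.inl ≫ biprod.lift biprod.snd biprod.fst ≫ split.inv, ?_⟩
    simpa using! distinguished_of_isos
      (binaryBiproductTriangle_distinguished (((emb A).obj B₁)⟦(1 : ℤ)⟧) ((emb A).obj B₀))
      (Iso.refl _) (biprod.braiding _ _ ≪≫ split.symm) (Iso.refl _)
  let O := Triangulated.someOctahedron' (u₁₂ := σ.toSigmaMinus _ hF) hf.symm hN hS hT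
  have hO : O.triangle ∈ distTriang (Db A) := O.mem
  have hUge : σ.Ge s U := Ge.ext hO hU₀.ge (ge_of_mem hB₁s le_rfl)
  have hneg : ∀ i : ℤ, i ≤ 0 → HomVanish U ((emb A).obj B₀) i := fun i hi =>
    homVanish_from₂ hO i (Gt.homVanish_of_nonpos hU₀ hB₀s hi)
      ((homVanish_shift_left_iff 1 i (i - 1) (by lia)).2 (homVanish_emb_of_neg _ _ (by lia)))
  have hθ : σ.theta U < σ.theta ((emb A).obj F) := by
    refine theta_lt_of_eq_add hKS hB₀0 hB₀s fun Y => ?_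
    have h1 : σ.theta ((emb A).obj F) Y = _ := theta_eq_add hKS hN hU₀ hVs Y
    have h2 : σ.theta U Y = _ := theta_eq_add hKS hO hU₀ hB₁s Y
    have h3 : multiplicity (σ.sigmaMinus _ hF) Y.1 = _ := hKS.multiplicity_iso Y.2.2 split
    rw [hKS.multiplicity_biprod Y.2.2] at h3
    rw [h1, h2]
    change _ + multiplicity (σ.sigmaMinus _ hF) Y.1 =
      (_ + multiplicity (((emb A).obj B₁)⟦(1 : ℤ)⟧) Y.1) + _
    rw [h3, add_comm (multiplicity _ _), ← add_assoc]
    rfl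
  have hU0 : ¬ IsZero U := fun h => by
    have := (Triangle.isZero₁_iff_isIso₂ _ hT).1 h
    exact hss (semistable_of_iso (asIso (Triangle.mk a ((emb A).map f) b).mor₂).symm
      ⟨hB₀0, s, hB₀s⟩)
  have hφ : s ≤ σ.phiMinus U := le_phiMinus hU0 hUge
  have hf0 : (emb A).map f ≠ 0 := mor₂_ne_zero_of_homVanish hT (hneg (-1) (by lia)) hB₀0
  have hUF1 : HomVanish U ((emb A).obj F) 1 :=
    homVanish_from₁ hT 1 2 (by lia) hFF1 (hher _ _ 2 le_rfl)
  have hUU1 : HomVanish U U 1 := homVanish_to₁ hT 0 1 (by lia) (hneg 0 le_rfl) hUF1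
  have r₁ : Retract ((emb A).obj A₁) U := (retractLeft _ _).trans (.ofIso eU.symm)
  have r₂ : Retract (((emb A).obj A₂)⟦(-1 : ℤ)⟧) U := (retractRight _ _).trans (.ofIso eU.symm)
  have hA₂A₂ : HomVanish ((emb A).obj A₂) ((emb A).obj A₂) 1 :=
    (homVanish_shift_iff (-1) (-1) 1 1 (by lia)).1 (HomVanish.of_retract r₂ r₂ hUU1)
  have toU : ∀ Γ : Db A, Retract Γ ((emb A).obj A₂) → Retract (Γ⟦(-1 : ℤ)⟧) U := fun Γ r =>
    (r.map (shiftFunctor _ (-1 : ℤ))).trans r₂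
  have hΓF : ∀ Γ : Db A, Retract Γ ((emb A).obj A₂) → ¬ IsZero Γ →
      ¬ HomVanish Γ ((emb A).obj F) 1 := fun Γ r hΓ h =>
    not_homVanish_obj₂_of_retract_obj₁ hT (hneg (-1) (by lia)) (toU Γ r)
      (fun h => hΓ ((isZero_shift_iff (-1)).1 h))
      ((homVanish_shift_left_iff (-1) 0 1 (by lia)).2 h)
  by_cases hFA₂ : HomVanish ((emb A).obj F) ((emb A).obj A₂) 1
  · left
    have hFU2 : HomVanish ((emb A).obj F) U 2 := by
      refine HomVanish.of_iso (Iso.refl _) eU (homVanish_to₂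
        (binaryBiproductTriangle_distinguished _ _) 2 (hher _ _ 2 le_rfl) ?_)
      exact (homVanish_shift_right_iff (-1) 2 1 (by lia)).2 hFA₂
    have hFB1 : HomVanish ((emb A).obj F) ((emb A).obj B₀) 1 :=
      homVanish_to₃ hT 1 2 (by lia) hFF1 hFU2
    have hBB1 : HomVanish ((emb A).obj B₀) ((emb A).obj B₀) 1 :=
      homVanish_from₃ hT 0 1 (by lia) (hneg 0 le_rfl) hFB1
    have hUB : HomVanishAll U ((emb A).obj B₀) := fun i => by
      obtain hi | rfl | hi : i ≤ 0 ∨ i = 1 ∨ 2 ≤ i := by lia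
      · exact hneg i hi
      · exact homVanish_from₁ hT 1 2 (by lia) hFB1 (hher _ _ 2 le_rfl)
      · exact homVanish_from₁ hT i (i + 1) rfl (hher _ _ i hi) (hher _ _ _ (by lia))
    have hA₁A₁ : HomVanish ((emb A).obj A₁) ((emb A).obj A₁) 1 := HomVanish.of_retract r₁ r₁ hUU1
    have hA₁B : HomVanishAll ((emb A).obj A₁) ((emb A).obj B₀) := fun i =>
      HomVanish.of_retract r₁ (.refl _) (hUB i)
    have hBΓ : ∀ Γ : Db A, Retract Γ U → ¬ IsZero Γ → ¬ HomVanish ((emb A).obj B₀) Γ 1 :=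
      fun Γ r hΓ => not_homVanish_obj₃_of_retract_obj₁ hT hexc hf0 r hΓ
    let T : AlgTriangle σ F hF :=
      { B₀ := B₀
        B₁ := B₁
        split := split
        U := U
        V := (emb A).obj B₀
        u := a
        v := (emb A).map f
        w := b
        dist := hT
        of_ne_zero _ := ⟨Iso.refl _, (Category.comp_id _).trans hf⟩
        of_zero h := (hB₀ h).elim }
    have reg : T.RegularFeatures :=
      ⟨hU0, ⟨hB₀0, s, hB₀s⟩, Or.inl ⟨Iso.refl _⟩, hθ, hB₀s, hφ, fun Γ hΓ => by
        obtain ⟨⟨r⟩, hΓ⟩ := hΓ.exists_retract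
        exact not_homVanish_obj₂_of_retract_obj₃ hT (hneg (-1) (by lia)) r hΓ.1, hUB, hUU1, hBB1⟩
    refine ⟨T, ?_⟩
    by_cases hA₂0 : IsZero A₂
    · left
      have : IsIso (biprod.inl : (emb A).obj A₁ ⟶ _ ⊞ ((emb A).obj A₂)⟦(-1 : ℤ)⟧) :=
        (Biprod.isIso_inl_iff_isZero _ _).2 ((isZero_shift_iff (-1)).2 (isZero_emb_iff.2 hA₂0))
      have e : U ≅ (emb A).obj A₁ := eU ≪≫ (asIso biprod.inl).symm
      refine ⟨reg, A₁, B₀, ⟨e⟩, ⟨Iso.refl _⟩, fun h => hU0 ((isZero_emb_iff.2 h).of_iso e), hB₀,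
        hA₁A₁, hBB1, hA₁B, ⟨Iso.refl _⟩, hB₀s, ?_, ?_, fun Γ hΓ => ?_⟩
      · rwa [← theta_iso hKS e]
      · exact le_phiMinus (fun h => hU0 (h.of_iso e)) (hUge.of_retract r₁)
      · obtain ⟨⟨r⟩, hΓ⟩ := hΓ.exists_retract
        exact hBΓ Γ (r.trans r₁) hΓ.1
    · right
      refine ⟨reg, A₁, A₂, B₀, ⟨eU⟩, ⟨Iso.refl _⟩, hA₂0, hB₀, ⟨m, hm, fun h => ?_⟩, hA₂A₂, hA₁A₁,
        hA₁B, fun i => ?_, fun i => ?_, ⟨Iso.refl _⟩, hB₀s, ?_, fun h => ?_, ?_, fun Γ hΓ => ?_,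
        fun Γ hΓ => ?_⟩
      · refine hf0 ?_
        rw [← IsIso.inv_hom_id_assoc m f, hmf, comp_zero, Functor.map_zero]
      · exact (homVanish_shift_left_iff (-1) (i - 1) i (by lia)).1
          (HomVanish.of_retract r₂ (.refl _) (hUB (i - 1)))
      · have key : ∀ j : ℤ, HomVanish U U (j + 1) →
            HomVanish ((emb A).obj A₁) ((emb A).obj A₂) j := fun j h =>
          (homVanish_shift_right_iff (-1) (j + 1) j (by lia)).1 (HomVanish.of_retract r₁ r₂ h)
        obtain hi | rfl | rfl | hi : i < 0 ∨ i = 0 ∨ i = 1 ∨ 2 ≤ i := by lia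
        · exact homVanish_emb_of_neg _ _ hi
        · exact key 0 hUU1
        · refine key 1 (homVanish_from₁ hT 2 3 (by lia) hFU2 ?_)
          refine HomVanish.of_iso (Iso.refl _) eU (homVanish_to₂
            (binaryBiproductTriangle_distinguished _ _) 3 (hher _ _ 3 (by lia)) ?_)
          exact (homVanish_shift_right_iff (-1) 3 2 (by lia)).2 (hher _ _ 2 le_rfl)
        · exact hher _ _ _ hi
      · rwa [← theta_biprod hKS, ← theta_iso hKS eU]
      · exact le_phiMinus (fun h' => h (isZero_emb_iff.1 h')) (hUge.of_retract r₁)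
      · exact le_phiMinus (fun h' => hA₂0 (isZero_emb_iff.1 ((isZero_shift_iff (-1)).1 h')))
          (hUge.of_retract r₂)
      · obtain ⟨⟨r⟩, hΓ⟩ := hΓ.exists_retract
        exact hBΓ Γ (r.trans r₁) hΓ.1
      · obtain ⟨⟨r⟩, hΓ⟩ := hΓ.exists_retract
        refine ⟨fun h => ?_, hΓF Γ r hΓ.1, HomVanish.of_retract (.refl _) r hFA₂⟩
        exact hBΓ _ (toU Γ r) (fun h => hΓ.1 ((isZero_shift_iff (-1)).1 h))
          ((homVanish_shift_right_iff (-1) 1 0 (by lia)).2 h)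
  · right
    obtain ⟨Γ, ⟨r⟩, hΓ, hFΓ⟩ := exists_summand_right hKS hFA₂
    have hΓΓ := HomVanish.of_retract r r hA₂A₂
    refine ⟨Γ, ⟨hexc, exceptionalIn_of_rigid k hher hKS hΓ hΓΓ, hFΓ, hΓF _ r hΓ.1⟩, ?_⟩
    -- here `Γ[-1]` is a summand of `U`, so that `Γ` lies in `P(≥ s + 1)`
    have e : (((emb A).obj Γ)⟦(-1 : ℤ)⟧)⟦(1 : ℤ)⟧ ≅ (emb A).obj Γ :=
      (shiftFunctorCompIsoId (Db A) (-1 : ℤ) 1 (by simp)).app _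
    have hΓs : σ.Ge (s + 1) ((emb A).obj Γ) :=
      ((hUge.of_retract (toU _ r)).shift 1 (s := s + 1) (by simp)).of_retract (.ofIso e.symm)
    intro G i p _ hp hG
    exact hΓs p (by linarith) _ hG

/-- An exceptional object of `A` which is not semistable either is regular or forms an
Ext-nontrivial couple with an obstruction to its regularity. -/
lemma regular_or_obstruction {σ : StabilityCondition (Db A)} {F : A}
    (hF : ¬ IsZero ((emb A).obj F)) (hexc : ExceptionalIn k F)
    (hss : ¬ σ.Semistable ((emb A).obj F)) :
    (∃ T : AlgTriangle σ F hF, T.IsC1 ∨ T.IsC2 ∨ T.IsC3) ∨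
      ∃ Γ, Obstruction k σ F (σ.phiMinus ((emb A).obj F)) Γ := by
  obtain ⟨B₀, B₁, ⟨split⟩⟩ := exists_sigmaMinus_iso hher σ hF
  by_cases hB₀ : IsZero B₀
  · exact (isC3_or_obstruction hher hKS hF hexc hss split hB₀).imp_left
      fun ⟨T, h⟩ => ⟨T, Or.inr (Or.inr h)⟩
  · exact (isC1_or_isC2_or_obstruction hher hKS hF hexc hss split hB₀).imp_left
      fun ⟨T, h⟩ => ⟨T, h.imp_right Or.inl⟩

end Dichotomy

/-! ### The RP properties exclude obstructions -/

section Final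

open StabilityCondition

variable {A : Type u} [Category.{v} A] [Abelian A] [HasDerivedCategory.{w} A]
  {k : Type t} [Field k] [Linear k A] (hher : Hereditary A) (hKS : KrullSchmidt (Db A) k)

lemma Exceptional.of_shift {X : Db A} (n : ℤ) (h : Exceptional k (X⟦n⟧)) : Exceptional k X :=
  (h.shift (-n)).of_iso ((shiftFunctorCompIsoId (Db A) n (-n) (by simp)).app X)

lemma Indecomposable.of_shift {X : Db A} (n : ℤ) (h : Indecomposable (X⟦n⟧)) : Indecomposable X :=
  ⟨fun h' => h.1 ((isZero_shift_iff n).2 h'), fun Y Z e =>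
    (h.2 _ _ ((shiftFunctor _ n).mapIso e ≪≫
      (nonempty_map_biprod_iso (shiftFunctor (Db A) n) Y Z).some)).imp
      (isZero_shift_iff n).1 (isZero_shift_iff n).1⟩

include hher hKS

/-- The case where the components of `V` lie in `A` as does the component `F` of `U`. A component `G`
of `V` with `Hom(R, G) ≠ 0` violates RP property 2. -/
lemma not_obstruction_of_RPProperty2 (h₂ : RPProperty2 A k) {σ : StabilityCondition (Db A)}
    {R : A} {hR : ¬ IsZero ((emb A).obj R)} (hRexc : ExceptionalIn k R) {T : AlgTriangle σ R hR}
    (reg : T.RegularFeatures) {B : A} (eV : T.V ≅ (emb A).obj B) {F : A}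
    (hF : ¬ IsZero ((emb A).obj F)) (r : Retract ((emb A).obj F) T.U) (Γ : A) :
    ¬ Obstruction k σ F (σ.phiMinus ((emb A).obj F)) Γ := by
  rintro ⟨hcouple, hΓ⟩
  have hRB : ¬ HomVanish ((emb A).obj R) ((emb A).obj B) 0 :=
    not_homVanish_obj₂_of_retract_obj₃ T.dist (reg.hom_U_V (-1)) (.ofIso eV.symm)
      fun h => reg.V_ss.1 (h.of_iso eV)
  obtain ⟨G, ⟨rG⟩, hG, hRG⟩ := exists_summand_right hKS hRB
  have rG' : Retract ((emb A).obj G) T.V := rG.trans (.ofIso eV.symm)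
  have hFG : HomVanishAll ((emb A).obj F) ((emb A).obj G) := fun i =>
    HomVanish.of_retract r rG' (reg.hom_U_V i)
  have hGexc : ExceptionalIn k G :=
    exceptionalIn_of_rigid k hher hKS hG (HomVanish.of_retract rG' rG' reg.hom_V_V)
  refine h₂ F Γ hcouple R G hRexc hGexc
    (not_homVanish_obj₂_of_retract_obj₁ T.dist (reg.hom_U_V (-1)) r hF) hRG hFG ?_
  refine hΓ G 0 (σ.phiMinus ((emb A).obj R)) hFG ?_
    (mem_shift 0 (mem_of_retract reg.phase_V rG') (by simp))
  exact le_phiMinus hF (((ge_phiMinus _ reg.U_ne).mono reg.phase_U).of_retract r)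

/-- The case where the components of `V` and the component of `U` lie in different shifts of `A`.
A component `G` of `B` with `Hom(G, F) ≠ 0` violates RP property 1. -/
lemma not_obstruction_of_RPProperty1 (h₁ : RPProperty1 A k) {σ : StabilityCondition (Db A)}
    {F B : A} {s q : ℝ} (hB : σ.P q ((emb A).obj B)) (hq : q + 1 ≤ s)
    (hBB : HomVanish ((emb A).obj B) ((emb A).obj B) 1)
    (hFB : HomVanishAll ((emb A).obj F) ((emb A).obj B))
    (hBF : ¬ HomVanish ((emb A).obj B) ((emb A).obj F) 0) (Γ : A) :
    ¬ Obstruction k σ F s Γ := by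
  rintro ⟨⟨hF, hΓ, hFΓ, hΓF⟩, hobs⟩
  obtain ⟨G, ⟨r⟩, hG, hGF⟩ := exists_summand_left hKS hBF
  have hFG : HomVanishAll ((emb A).obj F) ((emb A).obj G) := fun i =>
    HomVanish.of_retract (.refl _) r (hFB i)
  have hGexc : ExceptionalIn k G :=
    exceptionalIn_of_rigid k hher hKS hG (HomVanish.of_retract r r hBB)
  refine hGF (h₁ Γ F ⟨hΓ, hF, hΓF, hFΓ⟩ G hGexc (fun i => ?_) 0)
  obtain hi | hi : i ≤ 1 ∨ 2 ≤ i := by lia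
  · refine hobs G i (q + i) hFG ?_ (mem_shift i (mem_of_retract hB r) rfl)
    have : (i : ℝ) ≤ 1 := by exact_mod_cast hi
    linarith
  · exact hher _ _ i hi

/-- If no object is an obstruction, then a component of a shift of `U` is regular. -/
lemma isRegular_of_not_obstruction {σ : StabilityCondition (Db A)} {R : A}
    {hR : ¬ IsZero ((emb A).obj R)} {T : AlgTriangle σ R hR} (reg : T.RegularFeatures)
    {E : Db A} (hE : Indecomposable E) (hEss : ¬ σ.Semistable E) {M : A} {n j : ℤ}
    (rM : Retract (((emb A).obj M)⟦n⟧) T.U) (r : Retract E ((((emb A).obj M)⟦n⟧)⟦j⟧))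
    (h : ∀ F Γ : A, Retract ((emb A).obj F) ((emb A).obj M) → ExceptionalIn k F →
      ¬ Obstruction k σ F (σ.phiMinus ((emb A).obj F)) Γ) : IsRegular k σ E := by
  have e₀ : ∀ X : Db A, X⟦n + j⟧ ≅ (X⟦n⟧)⟦j⟧ := (shiftFunctorAdd (Db A) n j).app
  obtain ⟨F, ⟨rF⟩, ⟨e⟩⟩ := exists_iso_of_retract_emb_shift (n := n + j)
    (r.trans (.ofIso (e₀ _).symm))
  have hF : Indecomposable ((emb A).obj F) :=
    Indecomposable.of_shift (n + j) (Indecomposable.of_iso hE e)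
  have rF' := rF.map (emb A)
  have rFU := (rF'.map (shiftFunctor _ n)).trans rM
  have hexc : ExceptionalIn k F := exceptionalIn_of_rigid k hher hKS hF
    ((homVanish_shift_iff n n 1 1 (by lia)).1 (HomVanish.of_retract rFU rFU reg.hom_U_U))
  have hFss : ¬ σ.Semistable ((emb A).obj F) := fun h =>
    hEss (semistable_of_iso e.symm (semistable_of_shift (n + j) h))
  obtain ⟨T', hT'⟩ | ⟨Γ, hΓ⟩ := regular_or_obstruction hher hKS hF.1 hexc hFss
  · exact ⟨(Exceptional.shift hexc (n + j)).of_iso e.symm, hEss, F, n + j, hF.1, T', ⟨e⟩, hT'⟩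
  · exact (h F Γ rF' hexc hΓ).elim

theorem regularityPreserving (h₁ : RPProperty1 A k) (h₂ : RPProperty2 A k) :
    RegularityPreserving A k := by
  rintro σ X R S E - ⟨hR, -, R', j, hR', T, ⟨eR⟩, -, hE, hX⟩ hEss
  have hRexc : ExceptionalIn k R' := (hR.of_iso eR).of_shift j
  obtain ⟨⟨rE⟩, hEi⟩ := hE.exists_retract
  have e₀ : ∀ Y : Db A, Y⟦(0 : ℤ)⟧ ≅ Y := (shiftFunctorZero (Db A) ℤ).app
  have reg : T.RegularFeatures := by
    cases X with
    | C1 => exact hX.1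
    | C2a => exact hX.1
    | C2b => exact hX.1
    | C3 => exact hX.1
  have hv : T.v ≠ 0 :=
    mor₂_ne_zero_of_homVanish T.dist (reg.hom_U_V (-1)) reg.V_ss.1
  -- the components of an object of `A` which is a summand of `U`
  have key : ∀ M : A, Retract ((emb A).obj M) T.U → Retract E (((emb A).obj M)⟦j⟧) →
      (∀ F Γ : A, Retract ((emb A).obj F) ((emb A).obj M) → ExceptionalIn k F →
        ¬ Obstruction k σ F (σ.phiMinus ((emb A).obj F)) Γ) → IsRegular k σ E :=
    fun M rM r h => isRegular_of_not_obstruction hher hKS reg hEi hEss (n := 0) (j := j)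
      ((Retract.ofIso (e₀ _)).trans rM)
      (r.trans ((Retract.ofIso (e₀ _).symm).map (shiftFunctor _ j))) h
  cases X with
  | C1 =>
    obtain ⟨-, M, B, p⟩ := hX
    obtain ⟨eU⟩ := p.isoU
    obtain ⟨eV⟩ := p.isoV
    exact key M (.ofIso eU.symm) (rE.trans (.ofIso ((shiftFunctor _ j).mapIso eU)))
      fun F Γ r hF => not_obstruction_of_RPProperty2 hher hKS h₂ hRexc reg eV hF.not_isZero
        (r.trans (.ofIso eU.symm)) Γ
  | C2b =>
    obtain ⟨-, A₁, A₂, B, p, hE'⟩ := hX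
    obtain ⟨eU⟩ := p.isoU
    obtain ⟨eV⟩ := p.isoV
    have r₁ := (retractLeft _ _).trans (.ofIso eU.symm)
    exact key A₁ r₁ hE'.exists_retract.1.some
      fun F Γ r hF => not_obstruction_of_RPProperty2 hher hKS h₂ hRexc reg eV hF.not_isZero
        (r.trans r₁) Γ
  | C3 =>
    obtain ⟨-, M, B, p⟩ := hX
    obtain ⟨eU⟩ := p.isoU
    obtain ⟨eV⟩ := p.isoV
    refine key M (.ofIso eU.symm) (rE.trans (.ofIso ((shiftFunctor _ j).mapIso eU)))
      fun F Γ r hF => ?_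
    have rF := r.trans (.ofIso eU.symm)
    refine not_obstruction_of_RPProperty1 hher hKS h₁ p.phase_B ?_ p.hom_B_B
      (fun i => HomVanish.of_retract r (.refl _) (p.hom_X_B i)) (fun h => ?_) Γ
    · rw [sub_add_cancel]
      exact le_phiMinus hF.not_isZero (((ge_phiMinus _ reg.U_ne).mono reg.phase_U).of_retract rF)
    · refine not_homVanish_obj₃_of_retract_obj₁ T.dist hRexc hv rF hF.not_isZero ?_
      exact HomVanish.of_iso eV (Iso.refl _) ((homVanish_shift_left_iff 1 1 0 (by lia)).2 h)
  | C2a =>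
    obtain ⟨-, A₁, A₂, B, p, hE'⟩ := hX
    obtain ⟨eU⟩ := p.isoU
    obtain ⟨eV⟩ := p.isoV
    have r₂ := (retractRight _ _).trans (.ofIso eU.symm)
    refine isRegular_of_not_obstruction hher hKS reg hEi hEss r₂ hE'.exists_retract.1.some
      fun F Γ r hF => ?_
    have rF := (r.map (shiftFunctor _ (-1 : ℤ))).trans r₂
    refine not_obstruction_of_RPProperty1 hher hKS h₁ p.phase_B ?_
      (HomVanish.of_iso eV.symm eV.symm reg.hom_V_V)
      (fun i => HomVanish.of_retract r (.refl _) (p.hom_A₂_B i)) (fun h => ?_) Γ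
    · have e : (((emb A).obj F)⟦(-1 : ℤ)⟧)⟦(1 : ℤ)⟧ ≅ (emb A).obj F :=
        (shiftFunctorCompIsoId (Db A) (-1 : ℤ) 1 (by simp)).app _
      exact le_phiMinus hF.not_isZero
        (((((ge_phiMinus _ reg.U_ne).mono reg.phase_U).of_retract rF).shift 1
          (by simp)).of_retract (.ofIso e.symm))
    · exact not_homVanish_obj₃_of_retract_obj₁ T.dist hRexc hv rF
        (fun h => hF.not_isZero ((isZero_shift_iff (-1)).1 h))
        (HomVanish.of_iso eV (Iso.refl _) ((homVanish_shift_right_iff (-1) 1 0 (by lia)).2 h))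

end Final

end RegStab

end

theorem mainTheorem4 (k : Type t) [Field k] [IsAlgClosed k]
    (A : Type u) [Category.{v} A] [Abelian A] [Linear k A] [HasDerivedCategory.{w} A]
    (hfin : ∀ X Y : A, Module.Finite k (X ⟶ Y))
    (hher : RegStab.Hereditary A)
    (h₁ : RegStab.RPProperty1 A k) (h₂ : RegStab.RPProperty2 A k) :
    RegStab.RegularityPreserving A k :=
  RegStab.regularityPreserving hher (RegStab.krullSchmidt_Db k hfin hher) h₁ h₂
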